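/- Let $H$ be a finite simple graph on the vertex set $[h]=\{1,\dots,h\}$ and let $c>1$ be a real constant. All graphs are finite, simple and undirected. Definitions. A graph $G$ is a *blow-up* of $H$ if its vertex set can be partitioned into (possibly empty) sets $V_1,\dots,V_h$ such that for all $i,j\in[h]$ and all $u\in V_i$, $v\in V_j$, the pair $uv$ is an edge of $G$ if and only if $ij$ is an edge of $H$. A graph $G$ is a *blow-up collection* of $H$ if its vertex set can be partitioned into sets $V^1,\dots,V^k$, for some $k$, such that each induced subgraph $G|_{V^i}$ is a blow-up of $H$ and $G$ has no edges between $V^i$ and $V^j$ for $i\ne j$. For $\epsilon>0$ and $N\ge 1$ let $\Pi_{\epsilon,N}$ be the set of graphs on $[N]$ that have maximum degree at most $c\epsilon N$ and are blow-up collections of $H$. A graph $G$ on $[N]$ is $\epsilon$-*far* from $\Pi_{\epsilon,N}$ if at least $\epsilon N^2$ edges must be added to or deleted from $G$ to obtain a graph in $\Pi_{\epsilon,N}$ (every $G$ is $\epsilon$-far if $\Pi_{\epsilon,N}$ is empty). An *adaptive algorithm* on $N$-vertex graphs is a randomized algorithm that accesses the input graph $G$ only through queries "is $uv$ an edge of $G$?"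 with $u,v\in[N]$, where each query may depend on the algorithm's coin tosses and on the replies to the earlier queries, and that finally accepts or rejects; formally, it is a discrete probability distribution on finite decision trees. Theorem (Adaptive Tester). For every such $H$ and $c$ there is a constant $C>0$, depending only on $H$ and $c$, and a family of adaptive algorithms $\mathcal A_{\epsilon,N}$ such that for every $\epsilon\in(0,1)$ and every $N\ge 1$: 1. $\Pr[\mathcal A_{\epsilon,N}\text{ accepts }G]>2/3$ for every $G\in\Pi_{\epsilon,N}$; 2. $\Pr[\mathcal A_{\epsilon,N}\text{ rejects }G]>2/3$ for every graph $G$ on $[N]$ that is $\epsilon$-far from $\Pi_{\epsilon,N}$; 3. on every input graph on $[N]$ and for every outcome of its coin tosses, $\mathcal A_{\epsilon,N}$ makes at most $C\,\epsilon^{-1}\lg^3(\epsilon^{-1})$ queries, where $\lg=\log_2$. -/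

import Mathlib

open scoped symmDiff ENNReal

namespace DenseGraphTesting

/-- `G` is a blow-up of `H`. The map `f` encodes the partition of the vertices of `G` into the
(possibly empty) clusters `f ⁻¹' {i}`, one for each vertex `i` of `H`. -/
def IsBlowUp {V W : Type*} (G : SimpleGraph V) (H : SimpleGraph W) : Prop :=
  ∃ f : V → W, ∀ u v : V, G.Adj u v ↔ H.Adj (f u) (f v)

/-- `G` is a blow-up collection of `H`: the vertices split into parts `part ⁻¹' {i}`, `i < k`,
each inducing a blow-up of `H`, with no edges between distinct parts. -/
def IsBlowUpCollection {V W : Type*} (G : SimpleGraph V) (H : SimpleGraph W) : Prop :=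
  ∃ (k : ℕ) (part : V → Fin k),
    (∀ i : Fin k, IsBlowUp (G.induce {v | part v = i}) H) ∧
    ∀ u v : V, part u ≠ part v → ¬ G.Adj u v

/-- The graphs on `N` labelled vertices that are blow-up collections of `H`. -/
def blowUpCollections {W : Type*} (H : SimpleGraph W) (N : ℕ) : Set (SimpleGraph (Fin N)) :=
  {G | IsBlowUpCollection G H}

open Classical in
/-- The graphs on `N` labelled vertices with maximum degree at most `δ * N`. -/
def lowDegree (δ : ℝ) (N : ℕ) : Set (SimpleGraph (Fin N)) :=
  {G | (G.maxDegree : ℝ) ≤ δ * N}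

/-- The number of (unordered) edges that have to be added or deleted to turn `G` into `G'`. -/
noncomputable def editDistance {N : ℕ} (G G' : SimpleGraph (Fin N)) : ℕ :=
  (G.edgeSet ∆ G'.edgeSet).ncard

/-- `G` is `ε`-far from `P`: at least `ε * N ^ 2` edges have to be added or deleted to obtain
a graph in `P`. -/
def IsFar {N : ℕ} (ε : ℝ) (P : Set (SimpleGraph (Fin N))) (G : SimpleGraph (Fin N)) : Prop :=
  ∀ G' ∈ P, ε * (N : ℝ) ^ 2 ≤ editDistance G G'

/-- Deterministic adaptive algorithms with query access to a function
`Fin N → Fin N → Bool`: either stop with a verdict (`true` is "accept", `false` is "reject"),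
or query a pair and continue in a way that depends on the reply. -/
inductive DecisionTree (N : ℕ) : Type
  | output (verdict : Bool) : DecisionTree N
  | query (u v : Fin N) (next : Bool → DecisionTree N) : DecisionTree N

namespace DecisionTree

/-- The verdict when the queries are answered by `g`. -/
def run {N : ℕ} (g : Fin N → Fin N → Bool) : DecisionTree N → Bool
  | output verdict => verdict
  | query u v next => run g (next (g u v))

/-- The number of queries made when the queries are answered by `g`. -/
def queryCount {N : ℕ} (g : Fin N → Fin N → Bool) : DecisionTree N → ℕ
  | output _ => 0
  | query u v next => queryCount g (next (g u v)) + 1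

end DecisionTree

open Classical in
/-- The adjacency oracle of `G`. -/
noncomputable def oracle {N : ℕ} (G : SimpleGraph (Fin N)) : Fin N → Fin N → Bool :=
  fun u v => decide (G.Adj u v)

/-- Randomized adaptive algorithms for graphs on `N` vertices: all coins are tossed in advance,
and their outcome selects a deterministic adaptive algorithm. -/
abbrev AdaptiveAlgorithm (N : ℕ) : Type := PMF (DecisionTree N)

namespace AdaptiveAlgorithm

/-- The distribution of the verdict of `A` on input `G`. -/
noncomputable def verdict {N : ℕ} (A : AdaptiveAlgorithm N) (G : SimpleGraph (Fin N)) :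
    PMF Bool :=
  PMF.map (DecisionTree.run (oracle G)) A

/-- On every input graph and for every outcome of the coins, `A` makes at most `q` queries. -/
def MakesAtMost {N : ℕ} (A : AdaptiveAlgorithm N) (q : ℝ) : Prop :=
  ∀ T ∈ PMF.support A, ∀ G : SimpleGraph (Fin N), (T.queryCount (oracle G) : ℝ) ≤ q

/-- `A` is an `ε`-tester (with two-sided error) for the property `P`. -/
def IsTester {N : ℕ} (A : AdaptiveAlgorithm N) (ε : ℝ) (P : Set (SimpleGraph (Fin N))) : Prop :=
  (∀ G ∈ P, (2 / 3 : ℝ≥0∞) < A.verdict G true) ∧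
  ∀ G, IsFar ε P G → (2 / 3 : ℝ≥0∞) < A.verdict G false

end AdaptiveAlgorithm

end DenseGraphTesting

/-! Let d = ⌊cεN⌋. If d ≥ 1, one round (`trial`) samples pairs until it meets an edge, grows a list
from an endpoint by at most 2h+1 random neighbours of random list members, and tests the list by
sampling: degrees must not visibly exceed d, and some map to H must explain all adjacencies while
separating vertices seen to have different neighbourhoods. Every search takes m = O(1/ε) samples and
lists have bounded length, so boundedly many rounds cost O(1/ε) queries. The logarithmic factor is
at least 1 for ε < 1/2; for larger ε no graph is far.

Completeness: exploration never leaves a part of a blow-up collection, adjacency is read exactly,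
and a reported difference of neighbourhoods is always real. Only the degree test can err, which a
large m makes unlikely (`rej_trial_le_of_mem`).

Soundness (`le_rej_trial_of_isFar`): endpoints are found essentially in proportion to degree. So if
a round is rarely rejected, the vertices from which exploration is often rejected carry a small
share of the degree sum. Fix any other vertex u. By Markov's inequality, a list that is rarely
rejected stays so after appending all but few neighbours of its members (`card_not_promising_le`),
and such a list cannot be refuted. Appending vertices with new neighbourhoods stops with at most h
list members, since these map injectively to H (`exists_closed`). Almost all neighbours of the list
then fall into at most h classes of similar neighbourhoods, and two large classes are almost
completely or almost not joined (`pair_homogeneous`). Appending typical representatives shows that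
this pattern occurs in H (`exists_pattern`). So around u the graph is nearly a blow-up of H, nearly
separated from the rest (`hasLocalBlowUp`).

Taking for each vertex the first local blow-up that covers it glues these into one blow-up
collection, and isolating few vertices restores the exact degree bound (`exists_trimming`,
`exists_close_of_hasLocalBlowUp`). The total number of changes is below εN², so the graph was not
far. -/

namespace DenseGraphTesting

/-! ### Randomized query programs and their translation into distributions on decision trees -/

/-- Programs that toss fair coins with finitely many sides and query an oracle on `Fin N`. -/
inductive Prog (N : ℕ) (α : Type) : Type
  | ret (a : α) : Prog N α
  | coin (n : ℕ) (k : Fin (n + 1) → Prog N α) : Prog N α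
  | query (u v : Fin N) (k : Bool → Prog N α) : Prog N α

namespace Prog

variable {N : ℕ} {α β : Type}

/-- Sequential composition of programs. -/
def bind : Prog N α → (α → Prog N β) → Prog N β
  | ret a, f => f a
  | coin n k, f => coin n fun i => bind (k i) f
  | query u v k, f => query u v fun b => bind (k b) f

/-- The expectation of `f` at the output, when the queries are answered by `g`. -/
noncomputable def expect (g : Fin N → Fin N → Bool) : Prog N α → (α → ℝ) → ℝ
  | ret a, f => f a
  | coin n k, f => (∑ i, expect g (k i) f) / (n + 1)
  | query u v k, f => expect g (k (g u v)) f

/-- Every possible output satisfies `Q`, when the queries are answered by `g`. -/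
def Always (g : Fin N → Fin N → Bool) (Q : α → Prop) : Prog N α → Prop
  | ret a => Q a
  | coin _ k => ∀ i, Always g Q (k i)
  | query u v k => Always g Q (k (g u v))

/-- At most `q` queries are made, whatever the coins and the replies. -/
def CostLE : Prog N α → ℕ → Prop
  | ret _, _ => True
  | coin _ k, q => ∀ i, CostLE (k i) q
  | query _ _ _, 0 => False
  | query _ _ k, q + 1 => ∀ b, CostLE (k b) q

/-- The adaptive algorithm that tosses all coins of a program in advance. -/
noncomputable def toPMF : Prog N Bool → PMF (DecisionTree N)
  | ret b => PMF.pure (DecisionTree.output b)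
  | coin n k => (PMF.uniformOfFintype (Fin (n + 1))).bind fun i => toPMF (k i)
  -- The two subtrees are drawn independently, but any coupling would do: a run visits only one of
  -- them.
  | query u v k => (toPMF (k true)).bind fun s => (toPMF (k false)).bind fun t =>
      PMF.pure (DecisionTree.query u v fun b => cond b s t)

theorem expect_bind (g : Fin N → Fin N → Bool) (p : Prog N α) (k : α → Prog N β) (f : β → ℝ) :
    expect g (bind p k) f = expect g p fun a => expect g (k a) f := by
  induction p with
  | ret a => rfl
  | coin n k ih => simp only [bind, expect, ih]
  | query u v k ih => simp only [bind, expect, ih]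

theorem expect_mono_of_always {g : Fin N → Fin N → Bool} {Q : α → Prop} {p : Prog N α}
    (hp : Always g Q p) {f₁ f₂ : α → ℝ} (h : ∀ a, Q a → f₁ a ≤ f₂ a) :
    expect g p f₁ ≤ expect g p f₂ := by
  induction p with
  | ret a => exact h a hp
  | coin n k ih =>
    simp only [expect]
    gcongr with i
    exact ih i (hp i)
  | query u v k ih => exact ih _ hp

theorem always_true (g : Fin N → Fin N → Bool) (p : Prog N α) : Always g (fun _ => True) p := by
  induction p with
  | ret a => trivial
  | coin n k ih => exact ih
  | query u v k ih => exact ih _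

theorem always_bind {g : Fin N → Fin N → Bool} {Q : α → Prop} {Q' : β → Prop} {p : Prog N α}
    {k : α → Prog N β} (hp : Always g Q p) (hk : ∀ a, Q a → Always g Q' (k a)) :
    Always g Q' (bind p k) := by
  induction p with
  | ret a => exact hk a hp
  | coin n k ih => exact fun i => ih i (hp i)
  | query u v k ih => exact ih _ hp

theorem expect_mono (g : Fin N → Fin N → Bool) (p : Prog N α) {f₁ f₂ : α → ℝ}
    (h : ∀ a, f₁ a ≤ f₂ a) : expect g p f₁ ≤ expect g p f₂ :=
  expect_mono_of_always (always_true g p) fun a _ => h a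

theorem expect_const (g : Fin N → Fin N → Bool) (p : Prog N α) (x : ℝ) :
    (expect g p fun _ => x) = x := by
  induction p with
  | ret a => rfl
  | coin n k ih =>
    simp only [expect, ih, Finset.sum_const, Finset.card_univ, Fintype.card_fin, nsmul_eq_mul]
    push_cast
    field_simp
  | query u v k ih => exact ih _

theorem expect_add (g : Fin N → Fin N → Bool) (p : Prog N α) (f₁ f₂ : α → ℝ) :
    (expect g p fun a => f₁ a + f₂ a) = expect g p f₁ + expect g p f₂ := by
  induction p with
  | ret a => rfl
  | coin n k ih => simp only [expect, ih, Finset.sum_add_distrib, add_div]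
  | query u v k ih => exact ih _

theorem expect_mul_left (g : Fin N → Fin N → Bool) (p : Prog N α) (x : ℝ) (f : α → ℝ) :
    (expect g p fun a => x * f a) = x * expect g p f := by
  induction p with
  | ret a => rfl
  | coin n k ih => simp only [expect, ih, ← Finset.mul_sum, mul_div_assoc]
  | query u v k ih => exact ih _

theorem expect_nonneg (g : Fin N → Fin N → Bool) (p : Prog N α) {f : α → ℝ}
    (h : ∀ a, 0 ≤ f a) : 0 ≤ expect g p f := by
  have := expect_mono g p h
  rwa [expect_const] at this

theorem CostLE.mono {p : Prog N α} {q q' : ℕ} (h : CostLE p q) (hq : q ≤ q') : CostLE p q' := by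
  induction p generalizing q q' with
  | ret a => trivial
  | coin n k ih => exact fun i => ih i (h i) hq
  | query u v k ih =>
    cases q with
    | zero => exact h.elim
    | succ q =>
      cases q' with
      | zero => omega
      | succ q' => exact fun b => ih b (h b) (by omega)

theorem CostLE.bind {p : Prog N α} {k : α → Prog N β} {q q' : ℕ} (h : CostLE p q)
    (hk : ∀ a, CostLE (k a) q') : CostLE (p.bind k) (q + q') := by
  induction p generalizing q with
  | ret a => exact (hk a).mono (by omega)
  | coin n k ih => exact fun i => ih i (h i)
  | query u v k ih =>
    cases q with
    | zero => exact h.elim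
    | succ q =>
      rw [Nat.succ_add]
      exact fun b => ih b (h b)

theorem queryCount_le_of_mem_support {p : Prog N Bool} {q : ℕ} (h : CostLE p q)
    {T : DecisionTree N} (hT : T ∈ p.toPMF.support) (g : Fin N → Fin N → Bool) :
    T.queryCount g ≤ q := by
  induction p generalizing q T with
  | ret a =>
    simp only [toPMF, PMF.support_pure, Set.mem_singleton_iff] at hT
    simp [hT, DecisionTree.queryCount]
  | coin n k ih =>
    simp only [toPMF, PMF.mem_support_bind_iff] at hT
    obtain ⟨i, -, hi⟩ := hT
    exact ih i (h i) hi
  | query u v k ih =>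
    cases q with
    | zero => exact h.elim
    | succ q =>
      simp only [toPMF, PMF.mem_support_bind_iff, PMF.support_pure, Set.mem_singleton_iff] at hT
      obtain ⟨s, hs, t, ht, rfl⟩ := hT
      simp only [DecisionTree.queryCount]
      cases g u v
      · exact Nat.succ_le_succ (ih false (h false) ht)
      · exact Nat.succ_le_succ (ih true (h true) hs)

theorem map_run_toPMF (g : Fin N → Fin N → Bool) (p : Prog N Bool) (b : Bool) :
    (PMF.map (DecisionTree.run g) p.toPMF) b =
      ENNReal.ofReal (expect g p fun a => if a = b then 1 else 0) := by
  induction p with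
  | ret a =>
    simp only [toPMF, PMF.pure_map, DecisionTree.run, expect, PMF.pure_apply]
    by_cases h : a = b
    · simp [h]
    · simp [h, Ne.symm h]
  | coin n k ih =>
    simp only [toPMF, PMF.map_bind, PMF.bind_apply, ih, expect, PMF.uniformOfFintype_apply,
      tsum_fintype, Fintype.card_fin]
    rw [ENNReal.ofReal_div_of_pos (by positivity), ENNReal.ofReal_sum_of_nonneg, ← Finset.mul_sum,
      ENNReal.div_eq_inv_mul]
    · congr 2
      rw [← Nat.cast_succ, ENNReal.ofReal_natCast]
    · intro i _
      exact expect_nonneg _ _ fun a => by split_ifs <;> norm_num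
  | query u v k ih =>
    -- The subtree for the reply that does not occur integrates out.
    have key : PMF.map (DecisionTree.run g) (toPMF (query u v k)) =
        PMF.map (DecisionTree.run g) (toPMF (k (g u v))) := by
      simp only [toPMF, PMF.map_bind, PMF.pure_map, DecisionTree.run]
      cases hg : g u v
      · simp only [cond_false, PMF.bind_const]
        rfl
      · simp only [cond_true, PMF.bind_const]
        rfl
    rw [key, ih]
    rfl

/-! ### Searching by repeated samples, batches of tests, repetition -/

/-- Draw at most `m` samples and return the first one that is not `none`. -/
def firstHit (s : Prog N (Option α)) : ℕ → Prog N (Option α)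
  | 0 => ret none
  | m + 1 => s.bind fun o => match o with
    | some a => ret (some a)
    | none => firstHit s m

theorem costLE_firstHit {s : Prog N (Option α)} {q : ℕ} (hs : CostLE s q) (m : ℕ) :
    CostLE (firstHit s m) (m * q) := by
  induction m with
  | zero => trivial
  | succ m ih =>
    rw [Nat.succ_mul, add_comm (m * q)]
    refine hs.bind fun o => ?_
    cases o with
    | none => exact ih
    | some a => trivial

theorem always_firstHit {g : Fin N → Fin N → Bool} {s : Prog N (Option α)} {Q : α → Prop}
    (hs : Always g (fun o => ∀ a, o = some a → Q a) s) (m : ℕ) :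
    Always g (fun o => ∀ a, o = some a → Q a) (firstHit s m) := by
  induction m with
  | zero => exact fun a h => by simp at h
  | succ m ih =>
    refine always_bind hs fun o ho => ?_
    cases o with
    | none => exact ih
    | some a => exact ho

/-- The probability that a sample is a hit is `p`; then among `m` samples the first hit satisfies
a predicate about as often as it should. -/
theorem expect_firstHit_ge (g : Fin N → Fin N → Bool) (s : Prog N (Option α)) {p : ℝ}
    (hp : expect g s (fun o => o.elim 0 fun _ => 1) = p) (f : α → ℝ) (hf : ∀ a, 0 ≤ f a) (m : ℕ) :
    m / (1 + m * p) * expect g s (fun o => o.elim 0 f) ≤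
      expect g (firstHit s m) fun o => o.elim 0 f := by
  set y := expect g s (fun o => o.elim 0 f) with hy
  have hy0 : 0 ≤ y := expect_nonneg _ _ fun o => by cases o <;> simp [hf]
  have hp0 : 0 ≤ p := hp ▸ expect_nonneg _ _ fun o => by cases o <;> simp
  have hp1 : p ≤ 1 := by
    rw [← hp]
    refine (expect_mono _ _ fun o => ?_).trans (expect_const g s 1).le
    cases o <;> simp
  induction m with
  | zero => simp [firstHit, expect]
  | succ m ih =>
    set z := expect g (firstHit s m) (fun o => o.elim 0 f) with hz
    have key : expect g (firstHit s (m + 1)) (fun o => o.elim 0 f) = y + (1 - p) * z := by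
      have : ∀ o : Option α, expect g (match o with
          | some a => ret (some a)
          | none => firstHit s m) (fun o => o.elim 0 f) =
          o.elim 0 f + (z + (-z) * o.elim 0 fun _ => 1) := by
        intro o
        cases o with
        | none => simp [hz]
        | some a => simp [expect]
      rw [firstHit, expect_bind]
      simp only [this]
      rw [expect_add, expect_add, expect_const, expect_mul_left, hp, ← hy]
      ring
    rw [key]
    have h1 : 0 < 1 + (m : ℝ) * p := by positivity
    have h2 : 0 < 1 + ((m : ℝ) + 1) * p := by positivity
    have h3 : y + (1 - p) * (m / (1 + m * p) * y) ≤ y + (1 - p) * z := by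
      have := mul_le_mul_of_nonneg_left ih (sub_nonneg.2 hp1)
      linarith
    refine le_trans ?_ h3
    -- The numerators combine as (1 + mp) + (1 - p)m = m + 1; the goal then only needs a larger
    -- denominator.
    have h4 : y + (1 - p) * (m / (1 + m * p) * y) = (m + 1) / (1 + m * p) * y := by
      field_simp
      ring
    rw [h4]
    push_cast
    gcongr
    linarith

/-- Run the tests of a list and tabulate the results. -/
def gather {ι : Type} [DecidableEq ι] (d : α) (t : ι → Prog N α) : List ι → Prog N (ι → α)
  | [] => ret fun _ => d
  | i :: l => (t i).bind fun a => (gather d t l).bind fun r => ret (Function.update r i a)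

section gather

variable {ι : Type} [DecidableEq ι] {d : α} {t : ι → Prog N α} {g : Fin N → Fin N → Bool}

theorem costLE_gather {q : ℕ} (h : ∀ i, CostLE (t i) q) (l : List ι) :
    CostLE (gather d t l) (l.length * q) := by
  induction l with
  | nil => trivial
  | cons i l ih =>
    rw [List.length_cons, Nat.succ_mul, add_comm]
    exact (h i).bind fun a => (ih.bind (q' := 0) fun r => trivial)

theorem always_gather {Q : ι → α → Prop} {l : List ι} (h : ∀ i ∈ l, Always g (Q i) (t i)) :
    Always g (fun r => ∀ i ∈ l, Q i (r i)) (gather d t l) := by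
  induction l with
  | nil => exact fun i hi => by simp at hi
  | cons i l ih =>
    refine always_bind (h i (by simp)) fun a ha =>
      always_bind (ih fun j hj => h j (by simp [hj])) fun r hr => ?_
    intro j hj
    by_cases hji : j = i
    · subst hji
      simpa using ha
    · rw [Function.update_of_ne hji]
      exact hr j (by simpa [hji] using hj)

open Classical in
-- The tests are independent, so the success probabilities multiply.
theorem expect_gather_ge {Q : ι → α → Prop} {x : ℝ} (hx : 0 ≤ x) {l : List ι}
    (h : ∀ i ∈ l, x ≤ expect g (t i) fun a => if Q i a then 1 else 0) :
    x ^ l.length ≤ expect g (gather d t l) fun r => if ∀ i ∈ l, Q i (r i) then 1 else 0 := by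
  induction l with
  | nil => simp [gather, expect]
  | cons i l ih =>
    set y := expect g (gather d t l) fun r => if ∀ i ∈ l, Q i (r i) then (1 : ℝ) else 0
    have ih' := ih fun j hj => h j (by simp [hj])
    have hi := h i (by simp)
    rw [gather, expect_bind, List.length_cons, pow_succ]
    calc x ^ l.length * x ≤ y * expect g (t i) fun a => if Q i a then 1 else 0 :=
          mul_le_mul ih' hi hx ((pow_nonneg hx _).trans ih')
      _ = expect g (t i) fun a => y * if Q i a then 1 else 0 := (expect_mul_left _ _ _ _).symm
      _ ≤ _ := by
        refine expect_mono _ _ fun a => ?_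
        rw [expect_bind]
        by_cases ha : Q i a
        · simp only [ha, if_true, mul_one]
          refine expect_mono _ _ fun r => ?_
          simp only [expect]
          by_cases hr : ∀ i ∈ l, Q i (r i)
          · rw [if_pos hr, if_pos]
            intro j hj
            -- The list may repeat an entry; the outermost update wins, so only the result `a`
            -- matters at `i`.
            by_cases hji : j = i
            · subst hji
              simpa using ha
            · rw [Function.update_of_ne hji]
              exact hr j (by simpa [hji] using hj)
          · rw [if_neg hr]
            split_ifs <;> norm_num
        · simp only [ha, if_false, mul_zero]
          exact expect_nonneg _ _ fun r => by simp only [expect]; split_ifs <;> norm_num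

open Classical in
-- Union bound.
theorem expect_gather_le {Q : ι → α → Prop} {x : ℝ} {l : List ι}
    (h : ∀ i ∈ l, (expect g (t i) fun a => if Q i a then 1 else 0) ≤ x) :
    (expect g (gather d t l) fun r => if ∃ i ∈ l, Q i (r i) then 1 else 0) ≤ l.length * x := by
  induction l with
  | nil => simp [gather, expect]
  | cons i l ih =>
    set y := expect g (gather d t l) fun r => if ∃ i ∈ l, Q i (r i) then (1 : ℝ) else 0
    have ih' := ih fun j hj => h j (by simp [hj])
    have hi := h i (by simp)
    rw [gather, expect_bind, List.length_cons]
    calc _ ≤ expect g (t i) fun a => (if Q i a then 1 else 0) + y := by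
          refine expect_mono _ _ fun a => ?_
          rw [expect_bind, ← expect_const g (gather d t l) (if Q i a then 1 else 0), ← expect_add]
          refine expect_mono _ _ fun r => ?_
          simp only [expect]
          by_cases ha : Q i a
          · rw [if_pos ha]
            split_ifs <;> norm_num
          · rw [if_neg ha, zero_add]
            by_cases hr : ∃ i ∈ l, Q i (r i)
            · rw [if_pos hr]
              split_ifs <;> norm_num
            · rw [if_neg hr, if_neg]
              rintro ⟨j, hj, hQ⟩
              by_cases hji : j = i
              · subst hji
                rw [Function.update_self] at hQ
                exact ha hQ
              · rw [Function.update_of_ne hji] at hQ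
                exact hr ⟨j, by simpa [hji] using hj, hQ⟩
      _ = (expect g (t i) fun a => if Q i a then 1 else 0) + y := by
          rw [expect_add, expect_const]
      _ ≤ _ := by push_cast; linarith

end gather

/-- Run a test `t` times independently and accept if all runs accept. -/
def repeatAll (p : Prog N Bool) : ℕ → Prog N Bool
  | 0 => ret true
  | t + 1 => p.bind fun b => if b then repeatAll p t else ret false

theorem costLE_repeatAll {p : Prog N Bool} {q : ℕ} (h : CostLE p q) (t : ℕ) :
    CostLE (repeatAll p t) (t * q) := by
  induction t with
  | zero => trivial
  | succ t ih =>
    rw [Nat.succ_mul, add_comm (t * q)]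
    refine h.bind fun b => ?_
    cases b
    · trivial
    · exact ih

theorem expect_repeatAll (g : Fin N → Fin N → Bool) (p : Prog N Bool) (t : ℕ) :
    (expect g (repeatAll p t) fun a => if a = true then 1 else 0) =
      (expect g p fun a => if a = true then 1 else 0) ^ t := by
  induction t with
  | zero => simp [repeatAll, expect]
  | succ t ih =>
    rw [repeatAll, expect_bind, pow_succ, ← expect_mul_left]
    congr 1
    funext b
    cases b
    · simp [expect]
    · simpa using ih

theorem expect_eq_false (g : Fin N → Fin N → Bool) (p : Prog N Bool) :
    (expect g p fun a => if a = false then 1 else 0) =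
      1 - expect g p fun a => if a = true then 1 else 0 := by
  rw [eq_sub_iff_add_eq, ← expect_add]
  refine Eq.trans ?_ (expect_const g p 1)
  congr 1
  funext b
  cases b <;> simp only [reduceCtorEq, if_true, if_false] <;> norm_num

end Prog

/-! ### The tester and its query cost -/

open Classical in
/-- The neighbourhood of a vertex. -/
noncomputable def nb {V : Type*} [Fintype V] (G : SimpleGraph V) (v : V) : Finset V :=
  {w | G.Adj v w}

theorem mem_nb {V : Type*} [Fintype V] {G : SimpleGraph V} {v w : V} :
    w ∈ nb G v ↔ G.Adj v w := by
  simp [nb]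

open Classical in
/-- The vertices adjacent to exactly one of two given vertices. -/
noncomputable def nbDiff {V : Type*} [Fintype V] (G : SimpleGraph V) (v w : V) : Finset V :=
  {s | ¬ (G.Adj v s ↔ G.Adj w s)}

theorem mem_nbDiff {V : Type*} [Fintype V] {G : SimpleGraph V} {v w s : V} :
    s ∈ nbDiff G v w ↔ ¬ (G.Adj v s ↔ G.Adj w s) := by
  simp [nbDiff]

namespace Prog

variable {n : ℕ} (G : SimpleGraph (Fin (n + 1)))

/-- A random vertex, if it is a neighbour of `x`. -/
def nbSample (x : Fin (n + 1)) : Prog (n + 1) (Option (Fin (n + 1))) :=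
  coin n fun s => query x s fun b => ret (if b then some s else none)

/-- The first endpoint of a random pair, if the pair is an edge. -/
def edgeSample (n : ℕ) : Prog (n + 1) (Option (Fin (n + 1))) :=
  coin n fun u => coin n fun s => query u s fun b => ret (if b then some u else none)

/-- A random vertex, if it is adjacent to exactly one of `x` and `y`. -/
def distSample (x y : Fin (n + 1)) : Prog (n + 1) (Option Unit) :=
  coin n fun s => query x s fun b => query y s fun b' => ret (if b = b' then none else some ())

/-- The number of neighbours of `x` among `m` samples. -/
def countNb (x : Fin (n + 1)) : ℕ → Prog (n + 1) ℕ
  | 0 => ret 0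
  | m + 1 => coin n fun s => query x s fun b => (countNb x m).bind fun c =>
      ret (if b then c + 1 else c)

/-- Whether at most `θ` of `m` samples are neighbours of `x`. -/
noncomputable def degreeTest (m : ℕ) (θ : ℝ) (x : Fin (n + 1)) : Prog (n + 1) Bool :=
  (countNb x m).bind fun c => open Classical in ret (decide ((c : ℝ) ≤ θ))

/-- Whether a pair is an edge, and whether `m` samples tell its neighbourhoods apart. -/
def pairTest (m : ℕ) (e : Fin (n + 1) × Fin (n + 1)) : Prog (n + 1) (Bool × Bool) :=
  query e.1 e.2 fun b => (firstHit (distSample e.1 e.2) m).bind fun o => ret (b, o.isSome)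

/-- The results of all tests on a list of vertices are consistent with a blow-up of `H`. -/
def Consistent {h : ℕ} (H : SimpleGraph (Fin h)) (X : List (Fin (n + 1)))
    (r : Fin (n + 1) → Bool) (s : Fin (n + 1) × Fin (n + 1) → Bool × Bool) : Prop :=
  (∀ a ∈ X, r a = true) ∧ ∃ f : Fin (n + 1) → Fin h, ∀ a ∈ X, ∀ b ∈ X,
    ((s (a, b)).1 = true ↔ H.Adj (f a) (f b)) ∧ ((s (a, b)).2 = true → f a ≠ f b)

/-- Test whether a list of vertices may belong to one part of a blow-up collection. -/
noncomputable def check {h : ℕ} (H : SimpleGraph (Fin h)) (m : ℕ) (θ : ℝ)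
    (X : List (Fin (n + 1))) : Prog (n + 1) Bool :=
  (gather false (degreeTest m θ) X).bind fun r =>
    (gather (false, false) (pairTest m) (X ×ˢ X)).bind fun s =>
      open Classical in ret (decide (Consistent H X r s))

/-- Explore the graph from a list of vertices by random neighbours, then test the list. -/
noncomputable def explore {h : ℕ} (H : SimpleGraph (Fin h)) (m : ℕ) (θ : ℝ) :
    ℕ → List (Fin (n + 1)) → Prog (n + 1) Bool
  | 0, X => check H m θ X
  -- The coin has 2h+2 sides, the maximal list length, so every position is drawn with the same
  -- probability at every step; an index beyond the list wastes the step.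
  | r + 1, X => coin (2 * h + 1) fun i => match X[i.val]? with
    | none => explore H m θ r X
    | some x => (firstHit (nbSample x) m).bind fun o => match o with
      | none => explore H m θ r X
      | some w => explore H m θ r (w :: X)

/-- One round of the tester; the flag tells whether edges are allowed. -/
noncomputable def trial (n : ℕ) {h : ℕ} (H : SimpleGraph (Fin h)) (m : ℕ) (θ : ℝ) (e : Bool) :
    Prog (n + 1) Bool :=
  (firstHit (edgeSample n) m).bind fun o => match o with
    | none => ret true
    | some u => if e then explore H m θ (2 * h + 1) [u] else ret false

section cost

theorem costLE_nbSample (x : Fin (n + 1)) : CostLE (nbSample x) 1 := fun _ _ => trivial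

theorem costLE_edgeSample (n : ℕ) : CostLE (edgeSample n) 1 := fun _ _ _ => trivial

theorem costLE_distSample (x y : Fin (n + 1)) : CostLE (distSample x y) 2 :=
  fun _ _ _ => trivial

theorem costLE_countNb (x : Fin (n + 1)) (m : ℕ) : CostLE (countNb x m) m := by
  induction m with
  | zero => trivial
  | succ m ih => exact fun s b => ih.bind (q' := 0) fun _ => trivial

theorem costLE_check {h : ℕ} (H : SimpleGraph (Fin h)) {m : ℕ} (θ : ℝ) {X : List (Fin (n + 1))}
    {M : ℕ} (hX : X.length ≤ M) :
    CostLE (check H m θ X) (M * m + M * M * (m * 2 + 1)) := by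
  have h1 : ∀ x, CostLE (degreeTest m θ x) m := fun x : Fin (n + 1) =>
    (costLE_countNb x m).bind (q' := 0) fun _ => trivial
  have h2 : ∀ e, CostLE (pairTest m e) (m * 2 + 1) := fun e : Fin (n + 1) × Fin (n + 1) =>
    fun b => CostLE.bind (q' := 0) (costLE_firstHit (costLE_distSample _ _) m) fun _ => trivial
  refine (((costLE_gather h1 X).mono (Nat.mul_le_mul_right _ hX))).bind fun r => ?_
  refine CostLE.bind (q' := 0) ((costLE_gather h2 _).mono ?_) fun _ => trivial
  rw [List.length_product]
  exact Nat.mul_le_mul_right _ (Nat.mul_le_mul hX hX)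

theorem costLE_explore {h : ℕ} (H : SimpleGraph (Fin h)) {m : ℕ} (θ : ℝ) {M : ℕ} (r : ℕ)
    {X : List (Fin (n + 1))} (hX : X.length + r ≤ M) :
    CostLE (explore H m θ r X) (r * m + (M * m + M * M * (m * 2 + 1))) := by
  induction r generalizing X with
  | zero => exact (costLE_check H θ (by omega)).mono (by omega)
  | succ r ih =>
    have hX' : X.length + r ≤ M := by omega
    intro i
    show CostLE (match X[i.val]? with | none => _ | some x => _) _
    cases X[i.val]? with
    | none => exact (ih hX').mono (by gcongr; omega)
    | some x =>
      have h1 : CostLE (firstHit (nbSample x) m) (m * 1) :=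
        costLE_firstHit (costLE_nbSample x) m
      refine (h1.bind (q' := r * m + (M * m + M * M * (m * 2 + 1))) fun o => ?_).mono ?_
      · cases o with
        | none => exact ih hX'
        | some w =>
          refine ih (X := w :: X) ?_
          rw [List.length_cons]
          omega
      · rw [Nat.succ_mul]
        omega

theorem costLE_trial {h : ℕ} (H : SimpleGraph (Fin h)) {m : ℕ} (hm : 1 ≤ m) (θ : ℝ) (e : Bool) :
    CostLE (trial n H m θ e) (m * (3 * (2 * h + 2) * (2 * h + 2) + 2 * (2 * h + 2))) := by
  have h1 : CostLE (firstHit (edgeSample n) m) (m * 1) :=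
    costLE_firstHit (costLE_edgeSample n) m
  refine (h1.bind (q' := (2 * h + 1) * m + ((2 * h + 2) * m +
    (2 * h + 2) * (2 * h + 2) * (m * 2 + 1))) fun o => ?_).mono ?_
  · cases o with
    | none => trivial
    | some u =>
      cases e
      · trivial
      · exact costLE_explore H θ _ (by simp; omega)
  · nlinarith [Nat.mul_le_mul_left ((2 * h + 2) * (2 * h + 2)) hm]

end cost

/-! ### Probabilities for the sampling routines -/

section samples

theorem expect_nbSample (x : Fin (n + 1)) (f : Fin (n + 1) → ℝ) :
    (expect (oracle G) (nbSample x) fun o => o.elim 0 f) = (∑ w ∈ nb G x, f w) / (n + 1) := by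
  simp only [nbSample, expect, oracle, nb, Finset.sum_filter]
  congr 1
  refine Finset.sum_congr rfl fun s _ => ?_
  by_cases hs : G.Adj x s <;> simp [hs]

theorem expect_edgeSample (f : Fin (n + 1) → ℝ) :
    (expect (oracle G) (edgeSample n) fun o => o.elim 0 f) =
      (∑ u, (nb G u).card * f u) / (n + 1) ^ 2 := by
  simp only [edgeSample, expect, oracle, nb, ← Finset.sum_div]
  rw [div_div, ← sq]
  congr 1
  refine Finset.sum_congr rfl fun u _ => ?_
  rw [Finset.card_filter]
  push_cast
  rw [Finset.sum_mul]
  refine Finset.sum_congr rfl fun s _ => ?_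
  by_cases hs : G.Adj u s <;> simp [hs]

open Classical in
theorem expect_distSample (x y : Fin (n + 1)) (f : Unit → ℝ) :
    (expect (oracle G) (distSample x y) fun o => o.elim 0 f) =
      (nbDiff G x y).card * f () / (n + 1) := by
  simp only [distSample, expect, oracle]
  rw [nbDiff, Finset.card_filter]
  push_cast
  rw [Finset.sum_mul]
  congr 1
  refine Finset.sum_congr rfl fun s _ => ?_
  by_cases hs : G.Adj x s <;> by_cases hs' : G.Adj y s <;> simp [hs, hs']

/-- Each neighbour is found with probability at least m/((n+1) + m·deg), and both terms of the
denominator are bounded by multiples of md. Only an upper bound on the degree is needed. -/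
theorem expect_find_nb {x : Fin (n + 1)} {m : ℕ} {d : ℝ} (hd : 0 < d)
    (hm : (n + 1 : ℝ) ≤ m * d) (hx : ((nb G x).card : ℝ) ≤ 2 * d) {f : Fin (n + 1) → ℝ}
    (hf : ∀ a, 0 ≤ f a) :
    (∑ w ∈ nb G x, f w) / (3 * d) ≤
      expect (oracle G) (firstHit (nbSample x) m) fun o => o.elim 0 f := by
  have h1 := expect_firstHit_ge (oracle G) (nbSample x)
    (expect_nbSample G x fun _ => 1) f hf m
  refine le_trans ?_ h1
  rw [expect_nbSample]
  have hS : 0 ≤ ∑ w ∈ nb G x, f w := Finset.sum_nonneg fun w _ => hf w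
  have hm0 : (0 : ℝ) < m := by
    by_contra hcon
    have : (m : ℝ) * d ≤ 0 := mul_nonpos_of_nonpos_of_nonneg (not_lt.1 hcon) hd.le
    have : (0 : ℝ) < n + 1 := by positivity
    linarith
  simp only [Finset.sum_const, nsmul_eq_mul, mul_one]
  rw [div_mul_div_comm, div_le_div_iff₀ (by positivity) (by positivity)]
  have h2 : (1 + m * ((nb G x).card / ((n : ℝ) + 1))) * (n + 1) =
      (n + 1) + m * (nb G x).card := by
    field_simp
  rw [h2, mul_comm (m : ℝ) (∑ w ∈ nb G x, f w), mul_assoc (∑ w ∈ nb G x, f w)]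
  refine mul_le_mul_of_nonneg_left ?_ hS
  nlinarith [mul_le_mul_of_nonneg_left hx hm0.le]

/-- The search succeeds with probability at least 1/2, and the endpoint found is weighted by degree.
-/
theorem expect_find_edge {m : ℕ} (hm0 : 0 < m)
    (hm : ((n : ℝ) + 1) ^ 2 ≤ m * ∑ u, ((nb G u).card : ℝ)) {f : Fin (n + 1) → ℝ}
    (hf : ∀ a, 0 ≤ f a) :
    (∑ u, (nb G u).card * f u) / (2 * ∑ u, ((nb G u).card : ℝ)) ≤
      expect (oracle G) (firstHit (edgeSample n) m) fun o => o.elim 0 f := by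
  have h1 := expect_firstHit_ge (oracle G) (edgeSample n)
    (expect_edgeSample G fun _ => 1) f hf m
  refine le_trans ?_ h1
  rw [expect_edgeSample]
  have hS : 0 ≤ ∑ u, (nb G u).card * f u :=
    Finset.sum_nonneg fun w _ => mul_nonneg (by positivity) (hf w)
  generalize ∑ u, ((nb G u).card : ℝ) * f u = S at hS ⊢
  generalize hD : ∑ u, ((nb G u).card : ℝ) = D at hm ⊢
  have hm0' : (0 : ℝ) < m := by exact_mod_cast hm0
  have hD0 : 0 < D := by
    have : (0 : ℝ) < (n + 1) ^ 2 := by positivity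
    exact (mul_pos_iff_of_pos_left hm0').1 (this.trans_le hm)
  simp only [mul_one, hD]
  rw [div_mul_div_comm, div_le_div_iff₀ (by positivity) (by positivity)]
  have h2 : (1 + m * (D / ((n : ℝ) + 1) ^ 2)) * (n + 1) ^ 2 = (n + 1) ^ 2 + m * D := by
    field_simp
  rw [h2, mul_comm (m : ℝ) S, mul_assoc S]
  refine mul_le_mul_of_nonneg_left ?_ hS
  linarith

open Classical in
-- Variance plus squared bias of a binomial variable. The centre `a` is arbitrary because a
-- successful first sample shifts it to `a - 1` in the induction.
theorem expect_countNb (x : Fin (n + 1)) (m : ℕ) (a : ℝ) :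
    (expect (oracle G) (countNb x m) fun c => ((c : ℝ) - a) ^ 2) =
      m * ((nb G x).card / (n + 1)) * (1 - (nb G x).card / (n + 1)) +
        (m * ((nb G x).card / (n + 1)) - a) ^ 2 := by
  induction m generalizing a with
  | zero => simp [countNb, expect]
  | succ m ih =>
    set p : ℝ := (nb G x).card / (n + 1) with hp
    have h1 : ∀ s, (expect (oracle G) ((countNb x m).bind fun c =>
        ret (if oracle G x s then c + 1 else c)) fun c => ((c : ℝ) - a) ^ 2) =
        (if G.Adj x s then 1 else 0) * ((m * p - (a - 1)) ^ 2 - (m * p - a) ^ 2) +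
        (m * p * (1 - p) + (m * p - a) ^ 2) := by
      classical
      intro s
      rw [expect_bind]
      by_cases hs : G.Adj x s
      · have : oracle G x s = true := by simp [oracle, hs]
        simp only [expect, this, if_true, hs]
        have h2 := ih (a - 1)
        have h3 : ∀ c : ℕ, (((c + 1 : ℕ) : ℝ) - a) ^ 2 = ((c : ℝ) - (a - 1)) ^ 2 := by
          intro c; push_cast; ring
        simp only [h3]
        rw [h2]
        ring
      · have : oracle G x s = false := by simp [oracle, hs]
        simp [expect, this, hs, ih]
    simp only [countNb, expect, h1]
    rw [Finset.sum_add_distrib, ← Finset.sum_mul]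
    have h4 : ∑ s, (if G.Adj x s then (1 : ℝ) else 0) = p * (n + 1) := by
      classical
      rw [hp, nb, Finset.card_filter]
      push_cast
      field_simp
    rw [h4]
    simp only [Finset.sum_const, Finset.card_univ, Fintype.card_fin, nsmul_eq_mul]
    push_cast
    field_simp
    ring

/-- Chebyshev's inequality for the number of sampled neighbours. -/
theorem expect_countNb_deviation (x : Fin (n + 1)) (m : ℕ) {y : ℝ} (hy : 0 < y) {Q : ℕ → Prop}
    [DecidablePred Q] (hQ : ∀ c, Q c → y ≤ |(c : ℝ) - m * ((nb G x).card / (n + 1))|) :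
    (expect (oracle G) (countNb x m) fun c => if Q c then 1 else 0) ≤
      m * ((nb G x).card / (n + 1)) / y ^ 2 := by
  set p : ℝ := (nb G x).card / (n + 1) with hp
  have hp0 : 0 ≤ p := by positivity
  have h1 := expect_countNb G x m (m * p)
  rw [← hp, sub_self] at h1
  rw [le_div_iff₀ (by positivity), mul_comm, ← expect_mul_left]
  calc _ ≤ expect (oracle G) (countNb x m) fun c => ((c : ℝ) - m * p) ^ 2 := by
        refine expect_mono _ _ fun c => ?_
        split_ifs with h
        · rw [mul_one, ← sq_abs ((c : ℝ) - m * p)]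
          exact pow_le_pow_left₀ hy.le (hQ c h) 2
        · rw [mul_zero]
          positivity
    _ ≤ _ := by
        rw [h1]
        nlinarith [mul_nonneg (mul_nonneg (Nat.cast_nonneg (α := ℝ) m) hp0) hp0]

end samples

section tests

variable {G} {m : ℕ} {γ d : ℝ}

/-- The threshold corresponds to degree (1 + γ/2)d, halfway between the allowed d and the forbidden
(1 + γ)d; Chebyshev's inequality applies with deviation γ/2 · d, scaled by m/(n+1). -/
theorem expect_degreeTest_false_le (hγ : 0 < γ) (hd : 0 < d) (hm : 0 < m) {x : Fin (n + 1)}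
    (hx : ((nb G x).card : ℝ) ≤ d) :
    (expect (oracle G) (degreeTest m ((1 + γ / 2) * d * m / (n + 1)) x)
      fun a => if a = false then 1 else 0) ≤ 4 * (n + 1) / (γ ^ 2 * d * m) := by
  classical
  have hm' : (0 : ℝ) < m := by exact_mod_cast hm
  rw [degreeTest, expect_bind]
  simp only [expect]
  have h1 := expect_countNb_deviation G x m (y := γ / 2 * d * m / (n + 1)) (by positivity)
    (Q := fun c => ¬ (c : ℝ) ≤ (1 + γ / 2) * d * m / (n + 1)) (fun c hc => by
      refine le_trans ?_ (le_abs_self _)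
      have h2 : m * ((nb G x).card / ((n : ℝ) + 1)) ≤ m * (d / (n + 1)) := by gcongr
      have h3 : (1 + γ / 2) * d * m / ((n : ℝ) + 1) =
        m * (d / (n + 1)) + γ / 2 * d * m / (n + 1) := by ring
      linarith [not_le.1 hc])
  simp only [decide_eq_false_iff_not]
  refine h1.trans ?_
  calc _ ≤ m * (d / ((n : ℝ) + 1)) / (γ / 2 * d * m / (n + 1)) ^ 2 := by gcongr
    _ = _ := by
      field_simp
      norm_num

theorem expect_degreeTest_false_ge (hγ : 0 < γ) (hγ1 : γ ≤ 1) (hd : 0 < d)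
    (hm : 32 * (n + 1 : ℝ) ≤ m * (γ ^ 2 * d)) {x : Fin (n + 1)}
    (hx : (1 + γ) * d < ((nb G x).card : ℝ)) :
    1 / 2 ≤ (expect (oracle G) (degreeTest m ((1 + γ / 2) * d * m / (n + 1)) x)
      fun a => if a = false then 1 else 0) := by
  classical
  rw [expect_eq_false, degreeTest, expect_bind]
  simp only [expect]
  set D : ℝ := ((nb G x).card : ℝ) with hD
  have hm' : (0 : ℝ) < m := by
    by_contra hcon
    have : (m : ℝ) * (γ ^ 2 * d) ≤ 0 :=
      mul_nonpos_of_nonpos_of_nonneg (not_lt.1 hcon) (by positivity)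
    have : (0 : ℝ) < n + 1 := by positivity
    linarith
  have hdD : d < D := by nlinarith
  -- The gap is measured relative to D, since the variance grows with D and D has no upper bound
  -- here. The inequality amounts to (1 + γ)(1 - γ/4) ≥ 1 + γ/2, true for γ ≤ 1.
  have hdev : γ / 4 * D ≤ D - (1 + γ / 2) * d := by nlinarith
  have h1 := expect_countNb_deviation G x m (y := γ / 4 * D * m / (n + 1))
    (by have := hd.trans hdD; positivity)
    (Q := fun c => (c : ℝ) ≤ (1 + γ / 2) * d * m / (n + 1)) (fun c hc => by
      refine le_trans ?_ (neg_le_abs _)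
      have h2 : γ / 4 * D * m / ((n : ℝ) + 1) ≤ (D - (1 + γ / 2) * d) * m / (n + 1) := by gcongr
      have h3 : (D - (1 + γ / 2) * d) * m / ((n : ℝ) + 1) =
        m * (D / (n + 1)) - (1 + γ / 2) * d * m / (n + 1) := by ring
      linarith)
  simp only [decide_eq_true_eq]
  have h4 : m * (D / ((n : ℝ) + 1)) / (γ / 4 * D * m / (n + 1)) ^ 2 ≤ 1 / 2 := by
    have hD0 := hd.trans hdD
    have : m * (D / ((n : ℝ) + 1)) / (γ / 4 * D * m / (n + 1)) ^ 2 =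
        16 * (n + 1) / (m * (γ ^ 2 * D)) := by
      field_simp
      norm_num
    rw [this, div_le_div_iff₀ (by positivity) (by norm_num)]
    have : m * (γ ^ 2 * d) ≤ m * (γ ^ 2 * D) := by gcongr
    linarith
  linarith [h1.trans h4]

open Classical in
/-- The pair test is conclusive: it finds the adjacency, and the difference of the neighbourhoods
if it is large. -/
theorem expect_pairTest_ge (hγ : 0 < γ) (hd : 0 < d) (hm : (n + 1 : ℝ) ≤ m * (γ * d))
    (e : Fin (n + 1) × Fin (n + 1)) :
    1 / 2 ≤ expect (oracle G) (pairTest m e) fun a =>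
      if (a.1 = true ↔ G.Adj e.1 e.2) ∧
        (γ * d < ((nbDiff G e.1 e.2).card : ℝ) → a.2 = true) then 1 else 0 := by
  simp only [pairTest, expect, expect_bind]
  have hor : (oracle G e.1 e.2 = true) = G.Adj e.1 e.2 := by simp [oracle]
  simp only [hor, true_and, iff_self]
  by_cases hD : γ * d < ((nbDiff G e.1 e.2).card : ℝ)
  · have h1 := expect_firstHit_ge (oracle G) (distSample e.1 e.2)
      (expect_distSample G e.1 e.2 fun _ => 1) (fun _ => 1) (fun _ => zero_le_one) m
    rw [expect_distSample] at h1
    set D : ℝ := ((nbDiff G e.1 e.2).card : ℝ)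
    have hm' : (0 : ℝ) < m := by
      by_contra hcon
      have : (m : ℝ) * (γ * d) ≤ 0 :=
        mul_nonpos_of_nonpos_of_nonneg (not_lt.1 hcon) (by positivity)
      have : (0 : ℝ) < n + 1 := by positivity
      linarith
    have hD0 : 0 < D := lt_trans (by positivity) hD
    have h2 : 1 / 2 ≤ m / (1 + m * (D * 1 / (n + 1))) * (D * 1 / ((n : ℝ) + 1)) := by
      rw [mul_one, div_mul_div_comm, div_le_div_iff₀ (by norm_num) (by positivity)]
      have : (1 + m * (D / ((n : ℝ) + 1))) * (n + 1) = (n + 1) + m * D := by field_simp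
      rw [this]
      have : m * (γ * d) ≤ m * D := by gcongr
      linarith
    refine (h2.trans h1).trans (expect_mono _ _ fun o => ?_)
    cases o <;> simp [hD]
  · simp only [hD, false_imp_iff, if_true]
    rw [expect_const]
    norm_num

/-- The pair test errs on one side only: a reported difference has a witness. -/
theorem always_pairTest (e : Fin (n + 1) × Fin (n + 1)) :
    Always (oracle G) (fun a => (a.1 = true ↔ G.Adj e.1 e.2) ∧
      (a.2 = true → ∃ s, ¬ (G.Adj e.1 s ↔ G.Adj e.2 s))) (pairTest m e) := by
  refine always_bind (Q := fun o => ∀ a, o = some a → ∃ s, ¬ (G.Adj e.1 s ↔ G.Adj e.2 s))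
    (always_firstHit ?_ m) fun o ho => ?_
  · intro s a ha
    refine ⟨s, fun h => ?_⟩
    simp [oracle, h] at ha
  · refine ⟨by simp [oracle], fun h => ?_⟩
    cases o with
    | none => simp at h
    | some a => exact ho a rfl

end tests

end Prog

/-! ### Rejection probabilities: lower bounds for soundness -/

open Classical in
/-- A vertex of `X` has too large degree, or no partition of `X` as in a blow-up of `H` separates
the vertices whose neighbourhoods differ substantially. -/
def Refuted {V : Type*} [Fintype V] {h : ℕ} (G : SimpleGraph V) (H : SimpleGraph (Fin h))
    (γ d : ℝ) (X : List V) : Prop :=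
  (∃ x ∈ X, (1 + γ) * d < ((nb G x).card : ℝ)) ∨
    ¬ ∃ f : V → Fin h, ∀ a ∈ X, ∀ b ∈ X, (G.Adj a b ↔ H.Adj (f a) (f b)) ∧
      (γ * d < ((nbDiff G a b).card : ℝ) → f a ≠ f b)

theorem Refuted.mono {V : Type*} [Fintype V] {h : ℕ} {G : SimpleGraph V} {H : SimpleGraph (Fin h)}
    {γ d : ℝ} {X Y : List V} (hX : Refuted G H γ d X) (hXY : ∀ x ∈ X, x ∈ Y) :
    Refuted G H γ d Y := by
  rcases hX with ⟨x, hx, hd⟩ | hf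
  · exact Or.inl ⟨x, hXY x hx, hd⟩
  · refine Or.inr fun ⟨f, h⟩ => hf ⟨f, fun a ha b hb => h a (hXY a ha) b (hXY b hb)⟩

namespace Prog

/-- The probability that a program returns `false`. -/
noncomputable def rej {N : ℕ} (g : Fin N → Fin N → Bool) (p : Prog N Bool) : ℝ :=
  expect g p fun a => if a = false then 1 else 0

theorem rej_nonneg {N : ℕ} (g : Fin N → Fin N → Bool) (p : Prog N Bool) : 0 ≤ rej g p :=
  expect_nonneg _ _ fun a => by split_ifs <;> norm_num

theorem rej_bind {N : ℕ} {α : Type} (g : Fin N → Fin N → Bool) (p : Prog N α)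
    (k : α → Prog N Bool) : rej g (p.bind k) = expect g p fun a => rej g (k a) :=
  expect_bind _ _ _ _

variable {n : ℕ} {G : SimpleGraph (Fin (n + 1))} {h : ℕ} {H : SimpleGraph (Fin h)} {m : ℕ}
  {γ d θ : ℝ}

section soundness

/-- With probability at least 1/2 each, independently, all relevant tests are conclusive; a
consistent labelling would then contradict `Refuted`. The exponent M² covers both the degree tests
and the pair tests. -/
theorem rej_check_ge (hγ : 0 < γ) (hγ1 : γ ≤ 1) (hd : 0 < d)
    (hm : 32 * (n + 1 : ℝ) ≤ m * (γ ^ 2 * d)) {X : List (Fin (n + 1))}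
    (hX : Refuted G H γ d X) {M : ℕ} (hM : X.length ≤ M) :
    (1 / 2 : ℝ) ^ (M * M) ≤ rej (oracle G) (check H m ((1 + γ / 2) * d * m / (n + 1)) X) := by
  classical
  have hle : ∀ k ≤ M * M, (1 / 2 : ℝ) ^ (M * M) ≤ (1 / 2 : ℝ) ^ k := fun k hk =>
    pow_le_pow_of_le_one (by norm_num) (by norm_num) hk
  rw [check, rej_bind]
  simp only [rej_bind]
  rcases hX with ⟨x, hx, hdx⟩ | hf
  · have h1 : (1 / 2 : ℝ) ^ X.length ≤ expect (oracle G)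
        (gather false (degreeTest m ((1 + γ / 2) * d * m / (n + 1))) X) fun r =>
          if ∀ i ∈ X, ((1 + γ) * d < ((nb G i).card : ℝ) → r i = false) then 1 else 0 :=
      by
      convert expect_gather_ge (g := oracle G) (d := false)
        (t := degreeTest m ((1 + γ / 2) * d * m / (n + 1))) (x := 1 / 2) (l := X)
        (Q := fun i b => ((1 + γ) * d < ((nb G i).card : ℝ) → b = false))
        (by norm_num) fun i _ => ?_
      · by_cases hi : (1 + γ) * d < ((nb G i).card : ℝ)
        · simp only [hi, true_imp_iff]
          convert expect_degreeTest_false_ge hγ hγ1 hd hm hi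
        · simp only [hi, false_imp_iff, if_true, expect_const]
          norm_num
    refine (hle X.length (hM.trans (Nat.le_mul_self M))).trans (h1.trans (expect_mono _ _ fun r => ?_))
    split_ifs with hr
    · have : ∀ s, ¬ Consistent H X r s := fun s hs => by
        have h2 := hr x hx hdx
        rw [hs.1 x hx] at h2
        cases h2
      simp [rej, expect, this, expect_const]
    · exact expect_nonneg _ _ fun s => rej_nonneg _ _
  · have hm' : (n + 1 : ℝ) ≤ m * (γ * d) := by
      have : m * (γ ^ 2 * d) ≤ m * (γ * d) := by
        have : γ ^ 2 ≤ γ := by nlinarith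
        gcongr
      have h0 : (0 : ℝ) < n + 1 := by positivity
      linarith
    refine le_of_eq_of_le (expect_const _ _ _).symm (expect_mono _ _ fun r => ?_)
    have h1 := expect_gather_ge (g := oracle G) (d := ((false, false) : Bool × Bool))
      (t := pairTest m) (x := 1 / 2)
      (Q := fun e a => (a.1 = true ↔ G.Adj e.1 e.2) ∧
        (γ * d < ((nbDiff G e.1 e.2).card : ℝ) → a.2 = true)) (by norm_num)
      (l := X ×ˢ X) fun e _ => by
        convert expect_pairTest_ge (G := G) hγ hd hm' e
    rw [List.length_product] at h1
    refine (hle _ (Nat.mul_le_mul hM hM)).trans (h1.trans (expect_mono _ _ fun s => ?_))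
    split_ifs with hs
    · have : ¬ Consistent H X r s := by
        rintro ⟨-, f, hcon⟩
        refine hf ⟨f, fun a ha b hb => ?_⟩
        have h2 := hs (a, b) (List.pair_mem_product.2 ⟨ha, hb⟩)
        have h3 := hcon a ha b hb
        exact ⟨h2.1.symm.trans h3.1, fun h4 => h3.2 (h2.2 h4)⟩
      simp [rej, expect, this]
    · exact rej_nonneg _ _

theorem rej_explore_succ (r : ℕ) (X : List (Fin (n + 1))) :
    rej (oracle G) (explore H m θ (r + 1) X) = (∑ i : Fin (2 * h + 1 + 1),
      rej (oracle G) (match X[i.val]? with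
        | none => explore H m θ r X
        | some x => (firstHit (nbSample x) m).bind fun o => match o with
          | none => explore H m θ r X
          | some w => explore H m θ r (w :: X))) / (2 * h + 2) := by
  simp only [rej, explore, expect]
  push_cast
  congr 1
  ring

/-- A refuted list stays refuted when vertices are appended. -/
theorem rej_explore_ge (hγ : 0 < γ) (hγ1 : γ ≤ 1) (hd : 0 < d)
    (hm : 32 * (n + 1 : ℝ) ≤ m * (γ ^ 2 * d)) {M : ℕ} (r : ℕ) {X : List (Fin (n + 1))}
    (hX : Refuted G H γ d X) (hM : X.length + r ≤ M) :
    (1 / 2 : ℝ) ^ (M * M) ≤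
      rej (oracle G) (explore H m ((1 + γ / 2) * d * m / (n + 1)) r X) := by
  induction r generalizing X with
  | zero => exact rej_check_ge hγ hγ1 hd hm hX (by omega)
  | succ r ih =>
    have hM' : X.length + r ≤ M := by omega
    rw [rej_explore_succ, le_div_iff₀ (by positivity)]
    have : ∀ i : Fin (2 * h + 1 + 1), (1 / 2 : ℝ) ^ (M * M) ≤ rej (oracle G) (match X[i.val]? with
        | none => explore H m ((1 + γ / 2) * d * m / (n + 1)) r X
        | some x => (firstHit (nbSample x) m).bind fun o => match o with
          | none => explore H m ((1 + γ / 2) * d * m / (n + 1)) r X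
          | some w => explore H m ((1 + γ / 2) * d * m / (n + 1)) r (w :: X)) := by
      intro i
      cases X[i.val]? with
      | none => exact ih hX hM'
      | some x =>
        simp only [rej_bind]
        refine le_of_eq_of_le (expect_const _ _ _).symm (expect_mono _ _ fun o => ?_)
        cases o with
        | none => exact ih hX hM'
        | some w =>
          refine ih (hX.mono fun x hx => List.mem_cons_of_mem _ hx) ?_
          rw [List.length_cons]
          omega
    refine le_trans (le_of_eq ?_) (Finset.sum_le_sum fun i _ => this i)
    simp only [Finset.sum_const, Finset.card_univ, Fintype.card_fin, nsmul_eq_mul]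
    push_cast
    ring

/-- The position of `x` is drawn with probability 1/(2h+2), and then each neighbour is found with
probability at least 1/(3d). -/
theorem sum_rej_explore_le (hd : 0 < d) (hm : (n + 1 : ℝ) ≤ m * d) (r : ℕ)
    {X : List (Fin (n + 1))} (hM : X.length ≤ 2 * h + 2) {x : Fin (n + 1)} (hxX : x ∈ X)
    (hx : ((nb G x).card : ℝ) ≤ 2 * d) :
    ∑ w ∈ nb G x, rej (oracle G) (explore H m θ r (w :: X)) ≤
      3 * (2 * h + 2) * d * rej (oracle G) (explore H m θ (r + 1) X) := by
  obtain ⟨i, hi, rfl⟩ := List.getElem_of_mem hxX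
  have h1 := expect_find_nb G hd hm hx
    (f := fun w => rej (oracle G) (explore H m θ r (w :: X))) fun w => rej_nonneg _ _
  rw [div_le_iff₀ (by positivity)] at h1
  have h2 : (expect (oracle G) (firstHit (nbSample X[i]) m) fun o =>
      o.elim 0 fun w => rej (oracle G) (explore H m θ r (w :: X))) ≤
      (2 * h + 2) * rej (oracle G) (explore H m θ (r + 1) X) := by
    rw [rej_explore_succ, mul_div_cancel₀ _ (by positivity)]
    refine le_trans ?_ (Finset.single_le_sum (fun i _ => rej_nonneg _ _)
      (Finset.mem_univ (⟨i, by omega⟩ : Fin (2 * h + 1 + 1))))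
    simp only [List.getElem?_eq_getElem hi, rej_bind]
    refine expect_mono _ _ fun o => ?_
    cases o with
    | none => exact rej_nonneg _ _
    | some w => exact le_rfl
  calc _ ≤ _ := h1
    _ ≤ (2 * h + 2) * rej (oracle G) (explore H m θ (r + 1) X) * (3 * d) := by gcongr
    _ = _ := by ring

theorem sum_degree_rej_explore_le (hm0 : 0 < m)
    (hm : ((n : ℝ) + 1) ^ 2 ≤ m * ∑ u, ((nb G u).card : ℝ)) :
    ∑ u, ((nb G u).card : ℝ) * rej (oracle G) (explore H m θ (2 * h + 1) [u]) ≤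
      2 * (∑ u, ((nb G u).card : ℝ)) * rej (oracle G) (trial n H m θ true) := by
  have h1 := expect_find_edge G hm0 hm
    (f := fun u => rej (oracle G) (explore H m θ (2 * h + 1) [u])) fun w => rej_nonneg _ _
  have hD0 : 0 < ∑ u, ((nb G u).card : ℝ) := by
    have h0 : (0 : ℝ) < (n + 1) ^ 2 := by positivity
    exact (mul_pos_iff_of_pos_left (Nat.cast_pos.2 hm0)).1 (h0.trans_le hm)
  rw [div_le_iff₀ (by positivity), mul_comm _ (2 * ∑ u, ((nb G u).card : ℝ))] at h1
  refine h1.trans ?_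
  gcongr
  rw [trial, rej_bind]
  refine expect_mono _ _ fun o => ?_
  cases o with
  | none => exact rej_nonneg _ _
  | some w => exact le_rfl

theorem half_le_rej_trial_false (hm0 : 0 < m)
    (hm : ((n : ℝ) + 1) ^ 2 ≤ m * ∑ u, ((nb G u).card : ℝ)) :
    1 / 2 ≤ rej (oracle G) (trial n H m θ false) := by
  have h1 := expect_find_edge G hm0 hm (f := fun u => 1) fun w => zero_le_one
  have hD0 : 0 < ∑ u, ((nb G u).card : ℝ) := by
    have h0 : (0 : ℝ) < (n + 1) ^ 2 := by positivity
    exact (mul_pos_iff_of_pos_left (Nat.cast_pos.2 hm0)).1 (h0.trans_le hm)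
  simp only [mul_one] at h1
  have h2 : (∑ u, ((nb G u).card : ℝ)) / (2 * ∑ u, ((nb G u).card : ℝ)) = 1 / 2 := by
    field_simp
  rw [h2] at h1
  refine h1.trans ?_
  rw [trial, rej_bind]
  refine expect_mono _ _ fun o => ?_
  cases o with
  | none => exact rej_nonneg _ _
  | some w => simp [rej, expect]

end soundness

/-! ### Rejection probabilities: upper bounds for completeness -/

section completeness

/-- By `always_pairTest` the map `f` passes every pair test with certainty, so only a degree test
can cause rejection. -/
theorem rej_check_le (hγ : 0 < γ) (hd : 0 < d) (hm : 0 < m)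
    (hdeg : ∀ x, ((nb G x).card : ℝ) ≤ d) {X : List (Fin (n + 1))}
    (hX : ∃ f : Fin (n + 1) → Fin h, ∀ a ∈ X, ∀ b ∈ X, (G.Adj a b ↔ H.Adj (f a) (f b)) ∧
      (f a = f b → ∀ s, G.Adj a s ↔ G.Adj b s)) {M : ℕ} (hM : X.length ≤ M) :
    rej (oracle G) (check H m ((1 + γ / 2) * d * m / (n + 1)) X) ≤
      M * (4 * (n + 1) / (γ ^ 2 * d * m)) := by
  classical
  obtain ⟨f, hf⟩ := hX
  have hm' : (0 : ℝ) < m := by exact_mod_cast hm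
  have h1 := expect_gather_le (g := oracle G) (d := false)
    (t := degreeTest m ((1 + γ / 2) * d * m / (n + 1))) (Q := fun _ b => b = false) (l := X)
    (x := 4 * (n + 1) / (γ ^ 2 * d * m)) fun i _ => by
      convert expect_degreeTest_false_le hγ hd hm (hdeg i)
  refine le_trans ?_ (h1.trans (by gcongr))
  rw [check, rej_bind]
  refine expect_mono _ _ fun r => ?_
  rw [rej_bind]
  refine le_of_le_of_eq ?_ (expect_const (oracle G) (gather (false, false) (pairTest m) (X ×ˢ X)) _)
  refine expect_mono_of_always (always_gather fun e _ => always_pairTest e) fun s hs => ?_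
  by_cases hr : ∃ i ∈ X, r i = false
  · rw [if_pos hr]
    simp only [rej, expect]
    split_ifs <;> norm_num
  · rw [if_neg hr]
    have : Consistent H X r s := by
      refine ⟨fun a ha => ?_, f, fun a ha b hb => ?_⟩
      · by_contra hcon
        exact hr ⟨a, ha, by simpa using hcon⟩
      · have h2 := hs (a, b) (List.pair_mem_product.2 ⟨ha, hb⟩)
        refine ⟨h2.1.trans (hf a ha b hb).1, fun h3 h4 => ?_⟩
        obtain ⟨v, hv⟩ := h2.2 h3
        exact hv ((hf a ha b hb).2 h4 v)
    simp [rej, expect, this]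

/-- The set `S` is closed under adjacency, so the exploration stays inside it and one map explains
the whole list. -/
theorem rej_explore_le (hγ : 0 < γ) (hd : 0 < d) (hm : 0 < m)
    (hdeg : ∀ x, ((nb G x).card : ℝ) ≤ d) {S : Set (Fin (n + 1))}
    (hS : ∃ f : Fin (n + 1) → Fin h, ∀ a ∈ S, ∀ b ∈ S, (G.Adj a b ↔ H.Adj (f a) (f b)) ∧
      (f a = f b → ∀ s, G.Adj a s ↔ G.Adj b s))
    (hSadj : ∀ a ∈ S, ∀ b, G.Adj a b → b ∈ S) (r : ℕ)
    {X : List (Fin (n + 1))} (hX : ∀ a ∈ X, a ∈ S) {M : ℕ} (hM : X.length + r ≤ M) :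
    rej (oracle G) (explore H m ((1 + γ / 2) * d * m / (n + 1)) r X) ≤
      M * (4 * (n + 1) / (γ ^ 2 * d * m)) := by
  induction r generalizing X with
  | zero =>
    obtain ⟨f, hf⟩ := hS
    exact rej_check_le hγ hd hm hdeg ⟨f, fun a ha b hb => hf a (hX a ha) b (hX b hb)⟩ (by omega)
  | succ r ih =>
    have hM' : X.length + r ≤ M := by omega
    rw [rej_explore_succ, div_le_iff₀ (by positivity)]
    have : ∀ i : Fin (2 * h + 1 + 1), rej (oracle G) (match X[i.val]? with
        | none => explore H m ((1 + γ / 2) * d * m / (n + 1)) r X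
        | some x => (firstHit (nbSample x) m).bind fun o => match o with
          | none => explore H m ((1 + γ / 2) * d * m / (n + 1)) r X
          | some w => explore H m ((1 + γ / 2) * d * m / (n + 1)) r (w :: X)) ≤
          M * (4 * (n + 1) / (γ ^ 2 * d * m)) := by
      intro i
      rcases hx : X[i.val]? with _ | x
      · exact ih hX hM'
      · have hxX : x ∈ X := List.mem_of_getElem? hx
        simp only [rej_bind]
        have hnb : Always (oracle G) (fun o => ∀ w, o = some w → G.Adj x w) (nbSample x) := by
          intro s w hw
          by_contra hcon
          by_cases hs : G.Adj x s
          · simp only [oracle, hs, decide_true, if_true, Option.some.injEq] at hw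
            exact hcon (hw ▸ hs)
          · simp [oracle, hs] at hw
        refine le_of_le_of_eq (expect_mono_of_always (always_firstHit hnb m) fun o ho => ?_)
          (expect_const _ _ _)
        cases o with
        | none => exact ih hX hM'
        | some w =>
          refine ih (fun a ha => ?_) ?_
          · rcases List.mem_cons.1 ha with rfl | ha
            · exact hSadj x (hX x hxX) _ (ho _ rfl)
            · exact hX a ha
          · rw [List.length_cons]
            omega
    refine (Finset.sum_le_sum fun i _ => this i).trans (le_of_eq ?_)
    simp only [Finset.sum_const, Finset.card_univ, Fintype.card_fin, nsmul_eq_mul]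
    push_cast
    ring

theorem rej_trial_true_le (hγ : 0 < γ) (hd : 0 < d) (hm : 0 < m)
    (hdeg : ∀ x, ((nb G x).card : ℝ) ≤ d) (hG : IsBlowUpCollection G H) :
    rej (oracle G) (trial n H m ((1 + γ / 2) * d * m / (n + 1)) true) ≤
      (2 * h + 2 : ℕ) * (4 * (n + 1) / (γ ^ 2 * d * m)) := by
  obtain ⟨k, part, hpart, hcross⟩ := hG
  have hm' : (0 : ℝ) < m := by exact_mod_cast hm
  rw [trial, rej_bind]
  refine le_of_le_of_eq (expect_mono _ _ fun o => ?_) (expect_const _ _ _)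
  cases o with
  | none =>
    simp only [rej, expect]
    simp only [Bool.true_eq_false, if_false]
    positivity
  | some u =>
    simp only [if_true]
    have hsame : ∀ a b, G.Adj a b → part a = part b := fun a b hab => by
      by_contra hne
      exact hcross a b hne hab
    refine rej_explore_le hγ hd hm hdeg (S := {a | part a = part u}) ?_ ?_ _ ?_ ?_
    · obtain ⟨f, hf⟩ := hpart (part u)
      have hfu := f ⟨u, rfl⟩
      classical
      refine ⟨fun a => if ha : part a = part u then f ⟨a, ha⟩ else hfu, fun a ha b hb => ?_⟩
      have ha' : part a = part u := ha
      have hb' : part b = part u := hb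
      simp only [ha', hb', dite_true]
      refine ⟨hf ⟨a, ha⟩ ⟨b, hb⟩, fun hab s => ?_⟩
      -- Vertices of one cluster agree on all of G: inside the part by the blow-up structure,
      -- outside because no edge leaves the part.
      by_cases hs : part s = part u
      · have h1 := hf ⟨a, ha⟩ ⟨s, hs⟩
        have h2 := hf ⟨b, hb⟩ ⟨s, hs⟩
        rw [hab] at h1
        exact h1.trans h2.symm
      · refine iff_of_false (fun h => hs ?_) (fun h => hs ?_)
        · rw [← hsame _ _ h, ha']
        · rw [← hsame _ _ h, hb']
    · intro a ha b hab
      exact (hsame a b hab).symm.trans ha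
    · intro a ha
      rw [List.mem_singleton.1 ha]
      rfl
    · rw [List.length_singleton]
      omega

theorem rej_trial_false_eq_zero (hG : ∀ u v, ¬ G.Adj u v) :
    rej (oracle G) (trial n H m θ false) = 0 := by
  rw [trial, rej_bind]
  refine le_antisymm ?_ (expect_nonneg _ _ fun o => rej_nonneg _ _)
  have h1 : Always (oracle G) (fun o => ∀ w, o = some w → False) (edgeSample n) := by
    intro u s w hw
    simp [oracle, hG] at hw
  refine le_of_le_of_eq (expect_mono_of_always (always_firstHit h1 m) fun o ho => ?_)
    (expect_const (oracle G) (firstHit (edgeSample n) m) 0)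
  cases o with
  | none => simp [rej, expect]
  | some w => exact (ho w rfl).elim

end completeness

end Prog

/-! ### Sets of vertices with similar neighbourhoods -/

section neighbourhoods

open Classical in
theorem sum_card_filter_adj {V : Type*} {G : SimpleGraph V} (A B : Finset V) :
    ∑ u ∈ A, ((B.filter (G.Adj u)).card : ℝ) = ∑ w ∈ B, ((A.filter (G.Adj w)).card : ℝ) := by
  simp only [Finset.card_filter]
  push_cast
  rw [Finset.sum_comm]
  simp only [G.adj_comm]

open Classical in
theorem card_filter_adj_add {V : Type*} {G : SimpleGraph V} (u : V)
    (B : Finset V) :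
    ((B.filter (G.Adj u)).card : ℝ) + (B.filter fun w => ¬ G.Adj u w).card = B.card := by
  rw [← Nat.cast_add, Finset.card_filter_add_card_filter_not]

variable {V : Type*} [Fintype V] {G : SimpleGraph V}

theorem nbDiff_comm (u v : V) : nbDiff G u v = nbDiff G v u := by
  ext s
  rw [mem_nbDiff, mem_nbDiff]
  tauto

theorem card_nbDiff_triangle (u v w : V) :
    ((nbDiff G u w).card : ℝ) ≤ (nbDiff G u v).card + (nbDiff G v w).card := by
  classical
  rw [← Nat.cast_add, Nat.cast_le]
  refine (Finset.card_le_card ?_).trans (Finset.card_union_le _ _)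
  intro s
  rw [Finset.mem_union, mem_nbDiff, mem_nbDiff, mem_nbDiff]
  tauto

theorem card_nb_le (u v : V) : ((nb G u).card : ℝ) ≤ (nb G v).card + (nbDiff G u v).card := by
  classical
  rw [← Nat.cast_add, Nat.cast_le]
  refine (Finset.card_le_card ?_).trans (Finset.card_union_le _ _)
  intro s
  rw [Finset.mem_union, mem_nbDiff, mem_nb, mem_nb]
  tauto

open Classical in
theorem card_filter_adj_le (u v : V) (S : Finset V) :
    ((S.filter (G.Adj u)).card : ℝ) ≤ (S.filter (G.Adj v)).card + (nbDiff G u v).card := by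
  rw [← Nat.cast_add, Nat.cast_le]
  refine (Finset.card_le_card ?_).trans (Finset.card_union_le _ _)
  intro s
  rw [Finset.mem_union, mem_nbDiff, Finset.mem_filter, Finset.mem_filter]
  tauto

open Classical in
theorem card_filter_not_adj_le (u v : V) (S : Finset V) :
    ((S.filter fun w => ¬ G.Adj u w).card : ℝ) ≤
      (S.filter fun w => ¬ G.Adj v w).card + (nbDiff G u v).card := by
  rw [← Nat.cast_add, Nat.cast_le]
  refine (Finset.card_le_card ?_).trans (Finset.card_union_le _ _)
  intro s
  rw [Finset.mem_union, mem_nbDiff, Finset.mem_filter, Finset.mem_filter]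
  tauto

open Classical in
/-- If the vertices of `A` have similar neighbourhoods, and so do those of `B`, then the
neighbourhoods of the vertices of `A` contain almost none or almost all of `B`. -/
theorem rows_homogeneous {A B : Finset V} {t : ℝ}
    (hA : ∀ u ∈ A, ∀ u' ∈ A, ((nbDiff G u u').card : ℝ) ≤ t)
    (hB : ∀ u ∈ B, ∀ u' ∈ B, ((nbDiff G u u').card : ℝ) ≤ t) (ht : 0 ≤ t)
    (hAt : 2 * t < A.card) :
    (∀ u ∈ A, ((B.filter fun w => ¬ G.Adj u w).card : ℝ) ≤ 5 * t) ∨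
      ∀ u ∈ A, ((B.filter (G.Adj u)).card : ℝ) ≤ 5 * t := by
  have hA0 : (0 : ℝ) < A.card := by linarith
  obtain ⟨u₀, hu₀⟩ : A.Nonempty := Finset.card_pos.1 (by exact_mod_cast hA0)
  -- One vertex of `A` splits `B`. If one side has at most 4t elements, similarity within `A`
  -- transfers this to all of `A` at the cost of another t.
  set B₁ := B.filter (G.Adj u₀) with hB₁
  set B₀ := B.filter (fun w => ¬ G.Adj u₀ w) with hB₀
  by_cases h1 : (B₁.card : ℝ) ≤ 4 * t
  · refine Or.inr fun u hu => ?_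
    have := card_filter_adj_le (G := G) u u₀ B
    linarith [hA u hu u₀ hu₀]
  by_cases h0 : (B₀.card : ℝ) ≤ 4 * t
  · refine Or.inl fun u hu => ?_
    have := card_filter_not_adj_le (G := G) u u₀ B
    linarith [hA u hu u₀ hu₀]
  exfalso
  push Not at h1 h0
  have e1 : (A.card : ℝ) * (B₁.card - t) ≤ ∑ u ∈ A, ((B₁.filter (G.Adj u)).card : ℝ) := by
    rw [← nsmul_eq_mul]
    refine Finset.card_nsmul_le_sum _ _ _ fun u hu => ?_
    have h2 := card_filter_adj_le (G := G) u₀ u B₁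
    have h3 : B₁.filter (G.Adj u₀) = B₁ := by
      rw [hB₁, Finset.filter_filter]
      simp
    rw [h3] at h2
    linarith [hA u₀ hu₀ u hu]
  have e0 : ∑ u ∈ A, ((B₀.filter (G.Adj u)).card : ℝ) ≤ A.card * t := by
    rw [← nsmul_eq_mul]
    refine Finset.sum_le_card_nsmul _ _ _ fun u hu => ?_
    have h2 := card_filter_adj_le (G := G) u u₀ B₀
    have h3 : B₀.filter (G.Adj u₀) = ∅ := by
      rw [hB₀, Finset.filter_filter]
      simp
    rw [h3] at h2
    simp only [Finset.card_empty, Nat.cast_zero, zero_add] at h2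
    linarith [hA u hu u₀ hu₀]
  rw [sum_card_filter_adj] at e1 e0
  have p1 : (0 : ℝ) < B₁.card := by linarith
  have p0 : (0 : ℝ) < B₀.card := by linarith
  -- If both sides exceed 4t, double counting gives a vertex of `B₁` seeing at least 3/4 of `A` and
  -- one of `B₀` seeing at most 1/4; they differ on at least |A|/2 > t vertices, against similarity
  -- within `B`.
  obtain ⟨w₁, hw₁, e1'⟩ : ∃ w ∈ B₁, 3 / 4 * (A.card : ℝ) ≤ (A.filter (G.Adj w)).card := by
    by_contra hcon
    push Not at hcon
    have h2 := Finset.sum_lt_sum_of_nonempty (Finset.card_pos.1 (by exact_mod_cast p1)) hcon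
    rw [Finset.sum_const, nsmul_eq_mul] at h2
    nlinarith
  obtain ⟨w₀, hw₀, e0'⟩ : ∃ w ∈ B₀, ((A.filter (G.Adj w)).card : ℝ) ≤ 1 / 4 * A.card := by
    by_contra hcon
    push Not at hcon
    have h2 := Finset.sum_lt_sum_of_nonempty (Finset.card_pos.1 (by exact_mod_cast p0)) hcon
    rw [Finset.sum_const, nsmul_eq_mul] at h2
    nlinarith
  have h5 := card_filter_adj_le (G := G) w₁ w₀ A
  have h6 := hB w₁ (Finset.mem_filter.1 hw₁).1 w₀ (Finset.mem_filter.1 hw₀).1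
  linarith

open Classical in
theorem pair_homogeneous {A B : Finset V} {t : ℝ}
    (hA : ∀ u ∈ A, ∀ u' ∈ A, ((nbDiff G u u').card : ℝ) ≤ t)
    (hB : ∀ u ∈ B, ∀ u' ∈ B, ((nbDiff G u u').card : ℝ) ≤ t) (ht : 0 ≤ t)
    (hAt : 10 * t < A.card) (hBt : 10 * t < B.card) :
    ((∀ u ∈ A, ((B.filter fun w => ¬ G.Adj u w).card : ℝ) ≤ 5 * t) ∧
      ∀ u ∈ B, ((A.filter fun w => ¬ G.Adj u w).card : ℝ) ≤ 5 * t) ∨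
    ((∀ u ∈ A, ((B.filter (G.Adj u)).card : ℝ) ≤ 5 * t) ∧
      ∀ u ∈ B, ((A.filter (G.Adj u)).card : ℝ) ≤ 5 * t) := by
  -- The two directions cannot disagree: the number of edges would be both above and below |A||B|/2.
  have mixed : ∀ {A B : Finset V}, 10 * t < A.card → 10 * t < B.card →
      (∀ u ∈ A, ((B.filter fun w => ¬ G.Adj u w).card : ℝ) ≤ 5 * t) →
      (∀ u ∈ B, ((A.filter (G.Adj u)).card : ℝ) ≤ 5 * t) → False := by
    intro A B hAt hBt h1 h2
    have e1 : (A.card : ℝ) * (B.card - 5 * t) ≤ ∑ u ∈ A, ((B.filter (G.Adj u)).card : ℝ) := by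
      rw [← nsmul_eq_mul]
      refine Finset.card_nsmul_le_sum _ _ _ fun u hu => ?_
      linarith [card_filter_adj_add (G := G) u B, h1 u hu]
    have e2 : ∑ u ∈ B, ((A.filter (G.Adj u)).card : ℝ) ≤ B.card * (5 * t) := by
      rw [← nsmul_eq_mul]
      exact Finset.sum_le_card_nsmul _ _ _ h2
    rw [sum_card_filter_adj] at e1
    nlinarith
  rcases rows_homogeneous hA hB ht (by linarith) with h1 | h1 <;>
    rcases rows_homogeneous hB hA ht (by linarith) with h2 | h2
  · exact Or.inl ⟨h1, h2⟩
  · exact (mixed hAt hBt h1 h2).elim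
  · exact (mixed hBt hAt h2 h1).elim
  · exact Or.inr ⟨h1, h2⟩

end neighbourhoods

/-! ### From rare rejection to a local blow-up -/

section exploration

variable {V : Type*} [Fintype V] {h : ℕ} {G : SimpleGraph V} {H : SimpleGraph (Fin h)}
  {γ d ρ τ K : ℝ} {R : ℕ → List V → ℝ}

/-- The properties of the probability `R r X` that the exploration with `r` further steps starting
at the list `X` is rejected. -/
structure RejectionBounds (G : SimpleGraph V) (H : SimpleGraph (Fin h)) (γ d ρ K : ℝ)
    (R : ℕ → List V → ℝ) : Prop where
  nonneg : ∀ r X, 0 ≤ R r X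
  of_refuted : ∀ r X, X.length + r = 2 * h + 2 → Refuted G H γ d X → ρ ≤ R r X
  sum_le : ∀ r X, X.length + (r + 1) = 2 * h + 2 → ∀ x ∈ X, ((nb G x).card : ℝ) ≤ 2 * d →
    ∑ w ∈ nb G x, R r (w :: X) ≤ K * d * R (r + 1) X

/-- The exploration is unlikely to be rejected from `X`. -/
def Promising (h : ℕ) (ρ τ : ℝ) (R : ℕ → List V → ℝ) (r : ℕ) (X : List V) : Prop :=
  X.length + r = 2 * h + 2 ∧ R r X < ρ * τ ^ r

/-- The thresholds ρτ^r never exceed ρ, the least rejection probability of a refuted list. -/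
theorem RejectionBounds.not_refuted (hR : RejectionBounds G H γ d ρ K R) (hρ : 0 ≤ ρ) (hτ : 0 ≤ τ)
    (hτ1 : τ ≤ 1) {r : ℕ} {X : List V} (hX : Promising h ρ τ R r X) : ¬ Refuted G H γ d X := by
  intro hcon
  have h1 := hR.of_refuted r X hX.1 hcon
  have h2 : ρ * τ ^ r ≤ ρ * 1 := mul_le_mul_of_nonneg_left (pow_le_one₀ hτ hτ1) hρ
  linarith [hX.2]

open Classical in
-- Markov's inequality: each bad neighbour contributes at least ρτ^r to a sum below Kd·ρτ^(r+1).
-- This is why the threshold gains a factor τ with each remaining step.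
theorem RejectionBounds.card_not_promising_le (hR : RejectionBounds G H γ d ρ K R) (hρ : 0 < ρ)
    (hτ : 0 < τ) (hτ1 : τ ≤ 1) (hγ1 : γ ≤ 1) (hd : 0 < d) (hK : 0 < K) {r : ℕ} {X : List V}
    (hX : Promising h ρ τ R (r + 1) X) {x : V} (hx : x ∈ X) :
    (((nb G x).filter fun w => ¬ Promising h ρ τ R r (w :: X)).card : ℝ) ≤ K * τ * d := by
  have hdeg : ((nb G x).card : ℝ) ≤ 2 * d := by
    by_contra hcon
    refine hR.not_refuted hρ.le hτ.le hτ1 hX (Or.inl ⟨x, hx, ?_⟩)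
    nlinarith
  have h1 := hR.sum_le r X hX.1 x hx hdeg
  have hpos : 0 < ρ * τ ^ r := by positivity
  have h2 : (((nb G x).filter fun w => ¬ Promising h ρ τ R r (w :: X)).card : ℝ) * (ρ * τ ^ r) ≤
      ∑ w ∈ nb G x, R r (w :: X) := by
    refine le_trans ?_ (Finset.sum_le_sum_of_subset_of_nonneg
      (Finset.filter_subset (fun w => ¬ Promising h ρ τ R r (w :: X)) _)
      fun w _ _ => hR.nonneg r _)
    rw [← nsmul_eq_mul]
    refine Finset.card_nsmul_le_sum _ _ _ fun w hw => ?_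
    by_contra hcon
    refine (Finset.mem_filter.1 hw).2 ⟨?_, not_le.1 hcon⟩
    rw [List.length_cons]
    have := hX.1
    omega
  refine le_of_mul_le_mul_right (h2.trans (h1.trans ?_)) hpos
  have h3 : K * d * R (r + 1) X ≤ K * d * (ρ * τ ^ (r + 1)) :=
    mul_le_mul_of_nonneg_left hX.2.le (by positivity)
  refine h3.trans (le_of_eq ?_)
  ring

open Classical in
/-- The vertices whose neighbourhoods differ substantially from those of the vertices of `X`. -/
noncomputable def strangers (G : SimpleGraph V) (γ d : ℝ) (X : List V) : Finset V :=
  {w | ∀ y ∈ X, γ * d < ((nbDiff G w y).card : ℝ)}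

open Classical in
/-- A promising list of vertices with different neighbourhoods can be extended until almost all
neighbours of its vertices have neighbourhoods similar to those already seen. -/
theorem RejectionBounds.exists_closed (hR : RejectionBounds G H γ d ρ K R) (hρ : 0 < ρ)
    (hτ : 0 < τ) (hτ1 : τ ≤ 1) (hγ1 : γ ≤ 1) (hd : 0 < d) (hK : 0 < K)
    (hKτ : K * τ * (h + 1) ≤ γ) (k r : ℕ) {X : List V} (hX : Promising h ρ τ R r X)
    (hXk : X.length + k = h + 1)
    (hXp : X.Pairwise fun a b => γ * d < ((nbDiff G a b).card : ℝ)) :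
    ∃ Y s, Promising h ρ τ R s Y ∧ h + 1 ≤ s ∧ (∀ x ∈ X, x ∈ Y) ∧ Y.length ≤ h ∧
      ∀ x ∈ Y, ((nb G x ∩ strangers G γ d Y).card : ℝ) ≤ γ * d := by
  induction k generalizing r X with
  -- A list of h+1 pairwise distinguished vertices would be mapped injectively into the h vertices
  -- of H.
  | zero =>
    exfalso
    have h1 := hR.not_refuted hρ.le hτ.le hτ1 hX
    simp only [Refuted, not_or, not_not] at h1
    obtain ⟨f, hf⟩ := h1.2
    have h2 : (X.map f).Nodup := by
      rw [List.Nodup, List.pairwise_map]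
      exact hXp.imp_of_mem fun {a b} ha hb hab => (hf a ha b hb).2 hab
    have h3 := h2.length_le_card
    rw [List.length_map, Fintype.card_fin] at h3
    omega
  | succ k ih =>
    by_cases hcl : ∀ x ∈ X, ((nb G x ∩ strangers G γ d X).card : ℝ) ≤ γ * d
    · exact ⟨X, r, hX, by have := hX.1; omega, fun x hx => hx, by omega, hcl⟩
    push Not at hcl
    obtain ⟨x, hx, hxc⟩ := hcl
    obtain ⟨r, rfl⟩ : ∃ s, r = s + 1 := ⟨r - 1, by have := hX.1; omega⟩
    have h1 := hR.card_not_promising_le hρ hτ hτ1 hγ1 hd hK hX hx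
    have h2 : K * τ * d ≤ γ * d := by
      have : K * τ * 1 ≤ K * τ * (h + 1) :=
        mul_le_mul_of_nonneg_left (by linarith [Nat.cast_nonneg (α := ℝ) h]) (by positivity)
      exact mul_le_mul_of_nonneg_right (by linarith) hd.le
    -- Some list member has more than γd strangers as neighbours, but at most Kτd ≤ γd neighbours
    -- that spoil the list.
    obtain ⟨w, hw, hw'⟩ := Finset.exists_mem_notMem_of_card_lt_card
      (by exact_mod_cast lt_of_le_of_lt (h1.trans h2) hxc)
    rw [Finset.mem_inter] at hw
    have hwP : Promising h ρ τ R r (w :: X) := by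
      by_contra hcon
      exact hw' (Finset.mem_filter.2 ⟨hw.1, hcon⟩)
    obtain ⟨Y, s, hY, hs, hXY, hYl⟩ := ih r hwP (by rw [List.length_cons]; omega)
      (List.pairwise_cons.2 ⟨by simpa [strangers] using hw.2, hXp⟩)
    exact ⟨Y, s, hY, hs, fun x hx => hXY x (List.mem_cons_of_mem _ hx), hYl⟩

open Classical in
/-- A vertex of `X` with a similar neighbourhood, if there is one. -/
noncomputable def twin (G : SimpleGraph V) (γ d : ℝ) (X : List V) (w : V) : V :=
  if hw : ∃ y ∈ X, ((nbDiff G w y).card : ℝ) ≤ γ * d then hw.choose else w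

open Classical in
/-- The neighbours of vertices of `X` with a neighbourhood similar to that of `y`. -/
noncomputable def twinClass (G : SimpleGraph V) (γ d : ℝ) (X : List V) (y : V) : Finset V :=
  {w | (∃ x ∈ X, G.Adj x w) ∧ w ∉ strangers G γ d X ∧ twin G γ d X w = y}

theorem twin_spec {X : List V} {w : V} (hw : w ∉ strangers G γ d X) :
    twin G γ d X w ∈ X ∧ ((nbDiff G w (twin G γ d X w)).card : ℝ) ≤ γ * d := by
  have hw' : ∃ y ∈ X, ((nbDiff G w y).card : ℝ) ≤ γ * d := by
    simpa [strangers] using hw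
  rw [twin, dif_pos hw']
  exact hw'.choose_spec

theorem mem_twinClass {X : List V} {y w : V} : w ∈ twinClass G γ d X y ↔
    (∃ x ∈ X, G.Adj x w) ∧ w ∉ strangers G γ d X ∧ twin G γ d X w = y := by
  simp [twinClass]

theorem card_nbDiff_le_of_mem_twinClass {X : List V} {y w : V} (hw : w ∈ twinClass G γ d X y) :
    ((nbDiff G w y).card : ℝ) ≤ γ * d := by
  obtain ⟨-, h1, rfl⟩ := mem_twinClass.1 hw
  exact (twin_spec h1).2

open Classical in
/-- The classes of `y` and `z` are almost completely joined. -/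
def Joined (G : SimpleGraph V) (γ d : ℝ) (X : List V) (y z : V) : Prop :=
  (∀ u ∈ twinClass G γ d X y,
    (((twinClass G γ d X z).filter fun w => ¬ G.Adj u w).card : ℝ) ≤ 5 * (2 * (γ * d))) ∧
  ∀ u ∈ twinClass G γ d X z,
    (((twinClass G γ d X y).filter fun w => ¬ G.Adj u w).card : ℝ) ≤ 5 * (2 * (γ * d))

theorem Joined.symm {X : List V} {y z : V} (hyz : Joined G γ d X y z) : Joined G γ d X z y :=
  And.symm hyz

open Classical in
-- Any two members of a class are within γd of its centre, hence within 2γd of each other, so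
-- `pair_homogeneous` applies with t = 2γd.
theorem card_filter_not_joined_le (hγ : 0 ≤ γ) (hd : 0 ≤ d) {X : List V} {y z : V}
    (hy : 10 * (2 * (γ * d)) < (twinClass G γ d X y).card)
    (hz : 10 * (2 * (γ * d)) < (twinClass G γ d X z).card) {u : V}
    (hu : u ∈ twinClass G γ d X y) :
    (((twinClass G γ d X z).filter fun w => ¬ (G.Adj u w ↔ Joined G γ d X y z)).card : ℝ) ≤
      5 * (2 * (γ * d)) := by
  have hsim : ∀ y, ∀ u ∈ twinClass G γ d X y, ∀ u' ∈ twinClass G γ d X y,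
      ((nbDiff G u u').card : ℝ) ≤ 2 * (γ * d) := fun y u hu u' hu' => by
    have h1 := card_nbDiff_triangle (G := G) u y u'
    have h2 := card_nbDiff_le_of_mem_twinClass hu
    have h3 := card_nbDiff_le_of_mem_twinClass hu'
    rw [nbDiff_comm] at h3
    linarith
  by_cases hJ : Joined G γ d X y z
  · simpa [hJ] using hJ.1 u hu
  · rcases pair_homogeneous (hsim y) (hsim z) (by positivity) hy hz with h1 | h1
    · exact (hJ h1).elim
    · simpa [hJ] using h1.1 u hu

open Classical in
/-- Typical representatives of large classes can be found without being rejected. -/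
theorem RejectionBounds.exists_representatives (hR : RejectionBounds G H γ d ρ K R) (hρ : 0 < ρ)
    (hτ : 0 < τ) (hτ1 : τ ≤ 1) (hγ : 0 < γ) (hγ1 : γ ≤ 1) (hd : 0 < d) (hK : 0 < K)
    (hKτ : K * τ * (h + 1) ≤ γ) {X : List V} {r : ℕ} (hX : Promising h ρ τ R r X)
    (hXh : X.length ≤ h) (ys : List V) (hr : ys.length ≤ r) (hysl : ys.length ≤ h + 1)
    (hys : ∀ y ∈ ys, (10 * h + 21) * (γ * d) < ((twinClass G γ d X y).card : ℝ)) :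
    ∃ Z : List (V × V), Z.map Prod.fst = ys ∧ (∀ z ∈ Z, z.2 ∈ twinClass G γ d X z.1) ∧
      (Z.Pairwise fun z z' => G.Adj z.2 z'.2 ↔ Joined G γ d X z.1 z'.1) ∧
      Promising h ρ τ R (r - ys.length) (Z.map Prod.snd ++ X) := by
  induction ys with
  | nil => exact ⟨[], by simpa using hX⟩
  | cons y ys ih =>
    have hlen : (y :: ys).length = ys.length + 1 := rfl
    obtain ⟨Z, hZ1, hZ2, hZ3, hZ4⟩ := ih (by omega) (by omega)
      fun y hy => hys y (List.mem_cons_of_mem _ hy)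
    have hZlen : Z.length = ys.length := by rw [← hZ1, List.length_map]
    obtain ⟨s, hs⟩ : ∃ s, r - ys.length = s + 1 := ⟨r - ys.length - 1, by omega⟩
    have hs' : r - (y :: ys).length = s := by omega
    rw [hs] at hZ4
    set X' := Z.map Prod.snd ++ X with hX'
    -- `bad₁` collects the choices that spoil the list, at most γd in all by the choice of τ; `bad₂`
    -- those that are atypical for an earlier representative, at most 10hγd. The class size (10h +
    -- 21)γd exceeds their sum, and also the 20γd needed for homogeneity.
    set bad₁ := X.toFinset.biUnion fun x =>
      (nb G x).filter fun w => ¬ Promising h ρ τ R s (w :: X') with hbad₁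
    set bad₂ := Z.toFinset.biUnion fun z => (twinClass G γ d X y).filter fun w =>
      ¬ (G.Adj z.2 w ↔ Joined G γ d X z.1 y) with hbad₂
    have hγd : 0 < γ * d := by positivity
    have hh0 : (0 : ℝ) ≤ h := Nat.cast_nonneg h
    have b₁ : (bad₁.card : ℝ) ≤ γ * d := by
      have h1 : (bad₁.card : ℝ) ≤ ∑ x ∈ X.toFinset,
          (((nb G x).filter fun w => ¬ Promising h ρ τ R s (w :: X')).card : ℝ) := by
        exact_mod_cast Finset.card_biUnion_le
      have h2 := Finset.sum_le_card_nsmul X.toFinset (fun x =>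
          (((nb G x).filter fun w => ¬ Promising h ρ τ R s (w :: X')).card : ℝ)) (K * τ * d)
          fun x hx => hR.card_not_promising_le hρ hτ hτ1 hγ1 hd hK hZ4
            (List.mem_append_right _ (List.mem_toFinset.1 hx))
      rw [nsmul_eq_mul] at h2
      have h3 : (X.toFinset.card : ℝ) ≤ h + 1 := by
        have : X.toFinset.card ≤ h + 1 := (List.toFinset_card_le X).trans (by omega)
        exact_mod_cast this
      have h4 : (X.toFinset.card : ℝ) * (K * τ * d) ≤ (h + 1) * (K * τ * d) := by gcongr
      nlinarith
    have b₂ : (bad₂.card : ℝ) ≤ h * (5 * (2 * (γ * d))) := by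
      have h1 : (bad₂.card : ℝ) ≤ ∑ z ∈ Z.toFinset,
          (((twinClass G γ d X y).filter fun w =>
            ¬ (G.Adj z.2 w ↔ Joined G γ d X z.1 y)).card : ℝ) := by
        exact_mod_cast Finset.card_biUnion_le
      have hbig : ∀ y' ∈ y :: ys, 10 * (2 * (γ * d)) < ((twinClass G γ d X y').card : ℝ) :=
        fun y' hy' => by nlinarith [hys y' hy']
      have h2 := Finset.sum_le_card_nsmul Z.toFinset (fun z =>
          (((twinClass G γ d X y).filter fun w =>
            ¬ (G.Adj z.2 w ↔ Joined G γ d X z.1 y)).card : ℝ)) (5 * (2 * (γ * d)))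
          fun z hz => by
            have hz' := List.mem_toFinset.1 hz
            refine card_filter_not_joined_le hγ.le hd.le (hbig _ ?_) (hbig y (by simp))
              (hZ2 z hz')
            exact List.mem_cons_of_mem _ (hZ1 ▸ List.mem_map_of_mem hz')
      rw [nsmul_eq_mul] at h2
      have h3 : (Z.toFinset.card : ℝ) ≤ h := by
        have : Z.toFinset.card ≤ h := (List.toFinset_card_le Z).trans (by omega)
        exact_mod_cast this
      refine h1.trans (h2.trans ?_)
      gcongr
    obtain ⟨w, hw, hw'⟩ : ∃ w ∈ twinClass G γ d X y, w ∉ bad₁ ∪ bad₂ := by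
      refine Finset.exists_mem_notMem_of_card_lt_card ?_
      have h1 := hys y (by simp)
      have h2 : ((bad₁ ∪ bad₂).card : ℝ) ≤ bad₁.card + bad₂.card := by
        exact_mod_cast Finset.card_union_le _ _
      have h3 : ((bad₁ ∪ bad₂).card : ℝ) < (twinClass G γ d X y).card := by nlinarith
      exact_mod_cast h3
    rw [Finset.mem_union, not_or] at hw'
    refine ⟨(y, w) :: Z, by simp [hZ1], ?_, ?_, ?_⟩
    · intro z hz
      rcases List.mem_cons.1 hz with rfl | hz
      · exact hw
      · exact hZ2 z hz
    · refine List.pairwise_cons.2 ⟨fun z hz => ?_, hZ3⟩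
      by_contra hcon
      refine hw'.2 (Finset.mem_biUnion.2 ⟨z, List.mem_toFinset.2 hz,
        Finset.mem_filter.2 ⟨hw, fun h1 => hcon ?_⟩⟩)
      rw [G.adj_comm]
      exact h1.trans ⟨Joined.symm, Joined.symm⟩
    · rw [hs']
      by_contra hcon
      obtain ⟨x, hx, hxw⟩ := (mem_twinClass.1 hw).1
      exact hw'.1 (Finset.mem_biUnion.2 ⟨x, List.mem_toFinset.2 hx,
        Finset.mem_filter.2 ⟨mem_nb.2 hxw, hcon⟩⟩)

open Classical in
/-- The pattern of the large classes occurs in `H`. -/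
theorem RejectionBounds.exists_pattern (hR : RejectionBounds G H γ d ρ K R) (hρ : 0 < ρ)
    (hτ : 0 < τ) (hτ1 : τ ≤ 1) (hγ : 0 < γ) (hγ1 : γ ≤ 1) (hd : 0 < d) (hK : 0 < K)
    (hKτ : K * τ * (h + 1) ≤ γ) {X : List V} {r : ℕ} (hX : Promising h ρ τ R r X)
    (hXh : X.length ≤ h) (hr : h + 1 ≤ r) :
    ∃ φ : V → Fin h, ∀ y ∈ X, ∀ z ∈ X,
      (10 * h + 21) * (γ * d) < ((twinClass G γ d X y).card : ℝ) →
      (10 * h + 21) * (γ * d) < ((twinClass G γ d X z).card : ℝ) →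
      (Joined G γ d X y z ↔ H.Adj (φ y) (φ z)) := by
  have extract : ∀ {Z : List (V × V)} {s : ℕ}, Promising h ρ τ R s (Z.map Prod.snd ++ X) →
      ∃ f : V → Fin h, ∀ z ∈ Z, ∀ z' ∈ Z, G.Adj z.2 z'.2 ↔ H.Adj (f z.2) (f z'.2) := by
    intro Z s hZ
    have h1 := hR.not_refuted hρ.le hτ.le hτ1 hZ
    simp only [Refuted, not_or, not_not] at h1
    obtain ⟨f, hf⟩ := h1.2
    exact ⟨f, fun z hz z' hz' => (hf z.2 (List.mem_append_left _ (List.mem_map_of_mem hz)) z'.2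
      (List.mem_append_left _ (List.mem_map_of_mem hz'))).1⟩
  -- In a class joined to itself, h+1 representatives would form a clique, whose image in H would
  -- have h+1 distinct vertices.
  have hself : ∀ y, (10 * h + 21) * (γ * d) < ((twinClass G γ d X y).card : ℝ) →
      ¬ Joined G γ d X y y := by
    intro y hy hJ
    obtain ⟨Z, hZ1, hZ2, hZ3, hZ4⟩ := hR.exists_representatives hρ hτ hτ1 hγ hγ1 hd hK hKτ hX hXh
      (List.replicate (h + 1) y) (by simpa using hr) (by simp)
      fun y' hy' => by rwa [List.eq_of_mem_replicate hy']
    obtain ⟨f, hf⟩ := extract hZ4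
    have hfst : ∀ z ∈ Z, z.1 = y := fun z hz => by
      have : z.1 ∈ Z.map Prod.fst := List.mem_map_of_mem hz
      rw [hZ1] at this
      exact List.eq_of_mem_replicate this
    have hnd : (Z.map fun z => f z.2).Nodup := by
      rw [List.Nodup, List.pairwise_map]
      refine hZ3.imp_of_mem fun {a b} ha hb hab => ?_
      have h1 := hab.2 (by rwa [hfst a ha, hfst b hb])
      exact H.ne_of_adj ((hf a ha b hb).1 h1)
    have h2 := hnd.length_le_card
    have h3 : (Z.map Prod.fst).length = h + 1 := by rw [hZ1, List.length_replicate]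
    rw [List.length_map] at h2 h3
    rw [Fintype.card_fin] at h2
    omega
  -- One representative of each large class now carries the whole pattern into H at once.
  set big := X.toFinset.filter fun y =>
    (10 * h + 21) * (γ * d) < ((twinClass G γ d X y).card : ℝ) with hbig
  have hlen : big.toList.length ≤ h := by
    rw [Finset.length_toList]
    exact (Finset.card_filter_le _ _).trans ((List.toFinset_card_le X).trans hXh)
  obtain ⟨Z, hZ1, hZ2, hZ3, hZ4⟩ := hR.exists_representatives hρ hτ hτ1 hγ hγ1 hd hK hKτ hX hXh
    big.toList (by omega) (by omega)
    fun y hy => (Finset.mem_filter.1 (Finset.mem_toList.1 hy)).2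
  obtain ⟨f, hf⟩ := extract hZ4
  have hrep : ∀ y ∈ big, ∃ z ∈ Z, z.1 = y := fun y hy => by
    have : y ∈ Z.map Prod.fst := by rw [hZ1]; exact Finset.mem_toList.2 hy
    exact List.mem_map.1 this
  choose! rep hrepZ hrep1 using hrep
  have hsymm : Std.Symm fun z z' : V × V => G.Adj z.2 z'.2 ↔ Joined G γ d X z.1 z'.1 := by
    refine ⟨fun z z' hz => ?_⟩
    rw [G.adj_comm]
    exact hz.trans ⟨Joined.symm, Joined.symm⟩
  refine ⟨fun y => f (rep y).2, fun y hy z hz hyb hzb => ?_⟩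
  have hy' : y ∈ big := Finset.mem_filter.2 ⟨List.mem_toFinset.2 hy, hyb⟩
  have hz' : z ∈ big := Finset.mem_filter.2 ⟨List.mem_toFinset.2 hz, hzb⟩
  by_cases hyz : y = z
  · subst hyz
    exact iff_of_false (hself y hyb) (H.loopless.irrefl _)
  · have h1 := hZ3.forall (hrepZ y hy') (hrepZ z hz') fun h2 => hyz <| by
      rw [← hrep1 y hy', ← hrep1 z hz', h2]
    rw [hrep1 y hy', hrep1 z hz'] at h1
    exact h1.symm.trans (hf _ (hrepZ y hy') _ (hrepZ z hz'))

open Classical in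
/-- Around `u` the graph is close to a blow-up of `H` that is separated from the rest. -/
def HasLocalBlowUp (G : SimpleGraph V) (H : SimpleGraph (Fin h)) (κ d : ℝ) (u : V) : Prop :=
  ∃ (C : Finset V) (F : V → Fin h),
    ((nb G u \ C).card : ℝ) ≤ κ * d ∧ ((nb G u).card : ℝ) ≤ 2 * d ∧
    ∀ a ∈ C, ((nb G a \ C).card : ℝ) ≤ κ * d ∧ ((nb G a).card : ℝ) ≤ (1 + κ) * d ∧
      ((C.filter fun b => ¬ (G.Adj a b ↔ H.Adj (F a) (F b))).card : ℝ) ≤ κ * d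

open Classical in
-- The set `C` is the union of the large classes around a closed list. What it misses of a
-- neighbourhood consists of few strangers and at most h small classes.
theorem RejectionBounds.hasLocalBlowUp (hR : RejectionBounds G H γ d ρ K R) (hρ : 0 < ρ)
    (hτ : 0 < τ) (hτ1 : τ ≤ 1) (hγ : 0 < γ) (hγ1 : γ ≤ 1) (hd : 0 < d) (hK : 0 < K)
    (hKτ : K * τ * (h + 1) ≤ γ) (hh : 1 ≤ h) {u : V}
    (hu : R (2 * h + 1) [u] < ρ * τ ^ (2 * h + 1)) {κ : ℝ} (hκ : 40 * (h + 1) ^ 2 * γ ≤ κ) :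
    HasLocalBlowUp G H κ d u := by
  obtain ⟨X, r, hX, hr, huX, hXh, hcl⟩ := hR.exists_closed hρ hτ hτ1 hγ1 hd hK hKτ h
    (2 * h + 1) (X := [u]) ⟨by rw [List.length_singleton]; omega, hu⟩
    (by rw [List.length_singleton]; omega) (List.pairwise_singleton _ _)
  replace huX := huX u (by simp)
  obtain ⟨φ, hφ⟩ := hR.exists_pattern hρ hτ hτ1 hγ hγ1 hd hK hKτ hX hXh hr
  have hγd : 0 < γ * d := by positivity
  have hh1 : (1 : ℝ) ≤ h := by exact_mod_cast hh
  -- The constant absorbs the largest error below: two terms γd plus h small classes of size (10h +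
  -- 21)γd.
  have hκd : 40 * (h + 1) ^ 2 * (γ * d) ≤ κ * d := by nlinarith
  have hp : 0 ≤ h * (γ * d) := by positivity
  have hq : 0 ≤ (h : ℝ) ^ 2 * (γ * d) := by positivity
  have hXcard : (X.toFinset.card : ℝ) ≤ h := by
    exact_mod_cast (List.toFinset_card_le X).trans hXh
  have hdeg : ∀ y ∈ X, ((nb G y).card : ℝ) ≤ (1 + γ) * d := fun y hy => by
    by_contra hcon
    exact hR.not_refuted hρ.le hτ.le hτ1 hX (Or.inl ⟨y, hy, not_le.1 hcon⟩)
  set big := X.toFinset.filter fun y =>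
    (10 * h + 21) * (γ * d) < ((twinClass G γ d X y).card : ℝ) with hbig
  set C := big.biUnion fun y => twinClass G γ d X y with hC
  have hrest : ∀ y ∈ X, ((nb G y \ C).card : ℝ) ≤ γ * d + h * ((10 * h + 21) * (γ * d)) := by
    intro y hy
    set small := X.toFinset.filter fun y =>
      ¬ (10 * h + 21) * (γ * d) < ((twinClass G γ d X y).card : ℝ) with hsmall
    have h1 : nb G y \ C ⊆ (nb G y ∩ strangers G γ d X) ∪
        small.biUnion fun y => twinClass G γ d X y := by
      intro w hw
      rw [Finset.mem_sdiff] at hw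
      by_cases hws : w ∈ strangers G γ d X
      · exact Finset.mem_union_left _ (Finset.mem_inter.2 ⟨hw.1, hws⟩)
      · have hwt : w ∈ twinClass G γ d X (twin G γ d X w) :=
          mem_twinClass.2 ⟨⟨y, hy, mem_nb.1 hw.1⟩, hws, rfl⟩
        have hwX := List.mem_toFinset.2 (twin_spec hws).1
        refine Finset.mem_union_right _ (Finset.mem_biUnion.2 ⟨_, Finset.mem_filter.2 ⟨hwX, ?_⟩,
          hwt⟩)
        intro hcon
        exact hw.2 (Finset.mem_biUnion.2 ⟨_, Finset.mem_filter.2 ⟨hwX, hcon⟩, hwt⟩)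
    have h2 : ((nb G y \ C).card : ℝ) ≤ (nb G y ∩ strangers G γ d X).card +
        (small.biUnion fun y => twinClass G γ d X y).card := by
      exact_mod_cast (Finset.card_le_card h1).trans (Finset.card_union_le _ _)
    have h3 : ((small.biUnion fun y => twinClass G γ d X y).card : ℝ) ≤
        ∑ y ∈ small, ((twinClass G γ d X y).card : ℝ) := by
      exact_mod_cast Finset.card_biUnion_le
    have h4 := Finset.sum_le_card_nsmul small (fun y => ((twinClass G γ d X y).card : ℝ))
      ((10 * h + 21) * (γ * d)) fun y hy => not_lt.1 (Finset.mem_filter.1 hy).2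
    rw [nsmul_eq_mul] at h4
    have h5 : (small.card : ℝ) ≤ h :=
      le_trans (by exact_mod_cast Finset.card_filter_le _ _) hXcard
    have h6 : (small.card : ℝ) * ((10 * h + 21) * (γ * d)) ≤ h * ((10 * h + 21) * (γ * d)) := by
      gcongr
    linarith [hcl y hy]
  refine ⟨C, fun w => φ (twin G γ d X w), ?_, ?_, fun a ha => ?_⟩
  · refine (hrest u huX).trans (le_trans ?_ hκd)
    nlinarith [hp, hq]
  · refine (hdeg u huX).trans ?_
    gcongr
    linarith
  · obtain ⟨y, hy, hay⟩ := Finset.mem_biUnion.1 ha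
    have hyX : y ∈ X := List.mem_toFinset.1 (Finset.mem_filter.1 hy).1
    have hsim := card_nbDiff_le_of_mem_twinClass hay
    refine ⟨?_, ?_, ?_⟩
    · have h1 : nb G a \ C ⊆ nbDiff G a y ∪ (nb G y \ C) := by
        intro w
        rw [Finset.mem_union, Finset.mem_sdiff, Finset.mem_sdiff, mem_nbDiff, mem_nb, mem_nb]
        tauto
      have h2 : ((nb G a \ C).card : ℝ) ≤ (nbDiff G a y).card + (nb G y \ C).card := by
        exact_mod_cast (Finset.card_le_card h1).trans (Finset.card_union_le _ _)
      have h3 := hrest y hyX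
      refine le_trans ?_ hκd
      nlinarith [hp, hq]
    · have h1 := card_nb_le (G := G) a y
      have h2 := hdeg y hyX
      have h3 : 2 * (γ * d) ≤ κ * d := le_trans (by nlinarith [hp, hq]) hκd
      linarith
    · have h1 : (C.filter fun b =>
          ¬ (G.Adj a b ↔ H.Adj (φ (twin G γ d X a)) (φ (twin G γ d X b)))) ⊆
          big.biUnion fun z => (twinClass G γ d X z).filter fun b =>
            ¬ (G.Adj a b ↔ Joined G γ d X y z) := by
        intro b hb
        rw [Finset.mem_filter] at hb
        obtain ⟨z, hz, hbz⟩ := Finset.mem_biUnion.1 hb.1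
        refine Finset.mem_biUnion.2 ⟨z, hz, Finset.mem_filter.2 ⟨hbz, ?_⟩⟩
        have h2 := hb.2
        rw [(mem_twinClass.1 hay).2.2, (mem_twinClass.1 hbz).2.2] at h2
        rwa [hφ y hyX z (List.mem_toFinset.1 (Finset.mem_filter.1 hz).1)
          (Finset.mem_filter.1 hy).2 (Finset.mem_filter.1 hz).2]
      have h2 : ((C.filter fun b =>
          ¬ (G.Adj a b ↔ H.Adj (φ (twin G γ d X a)) (φ (twin G γ d X b)))).card : ℝ) ≤
          ∑ z ∈ big, (((twinClass G γ d X z).filter fun b =>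
            ¬ (G.Adj a b ↔ Joined G γ d X y z)).card : ℝ) := by
        exact_mod_cast (Finset.card_le_card h1).trans Finset.card_biUnion_le
      have hbig' : ∀ z ∈ big, 10 * (2 * (γ * d)) < ((twinClass G γ d X z).card : ℝ) :=
        fun z hz => by nlinarith [(Finset.mem_filter.1 hz).2]
      have h3 := Finset.sum_le_card_nsmul big (fun z => (((twinClass G γ d X z).filter fun b =>
            ¬ (G.Adj a b ↔ Joined G γ d X y z)).card : ℝ)) (5 * (2 * (γ * d))) fun z hz =>
          card_filter_not_joined_le hγ.le hd.le (hbig' y hy) (hbig' z hz) hay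
      rw [nsmul_eq_mul] at h3
      have h5 : (big.card : ℝ) ≤ h :=
        le_trans (by exact_mod_cast Finset.card_filter_le _ _) hXcard
      have h6 : (big.card : ℝ) * (5 * (2 * (γ * d))) ≤ h * (5 * (2 * (γ * d))) := by gcongr
      refine h2.trans (h3.trans (h6.trans (le_trans ?_ hκd)))
      nlinarith [hp, hq]

end exploration

/-! ### Gluing local blow-ups and trimming degrees -/

/-- The graph whose parts are the fibres of `p` over proper values and whose clusters are given
by `f`; the vertices that `p` sends to `none` are isolated. -/
def clusterGraph {V ι W : Type*} (p : V → Option ι) (f : V → W) (H : SimpleGraph W) :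
    SimpleGraph V where
  Adj a b := p a = p b ∧ p a ≠ none ∧ H.Adj (f a) (f b)
  symm := ⟨fun _ _ hab => ⟨hab.1.symm, hab.1 ▸ hab.2.1, hab.2.2.symm⟩⟩
  loopless := ⟨fun _ h => H.loopless.irrefl _ h.2.2⟩

/-- The isolated vertices form one extra part, a blow-up under a constant map since H has no loops.
-/
theorem isBlowUpCollection_clusterGraph {V ι W : Type*} [Fintype ι] [Nonempty W]
    (p : V → Option ι) (f : V → W) (H : SimpleGraph W) :
    IsBlowUpCollection (clusterGraph p f H) H := by
  refine ⟨_, fun a => Fintype.equivFin (Option ι) (p a), fun i => ?_, fun u v huv hadj => ?_⟩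
  · obtain ⟨j, rfl⟩ := (Fintype.equivFin (Option ι)).surjective i
    cases j with
    | none =>
      refine ⟨fun _ => Classical.arbitrary W, fun u v => iff_of_false ?_ (H.loopless.irrefl _)⟩
      intro h
      exact h.2.1 ((Fintype.equivFin (Option ι)).injective u.2)
    | some j =>
      refine ⟨fun u => f u, fun u v => ?_⟩
      have hu := (Fintype.equivFin (Option ι)).injective u.2
      have hv := (Fintype.equivFin (Option ι)).injective v.2
      show (p u = p v ∧ p u ≠ none ∧ H.Adj (f u) (f v)) ↔ H.Adj (f u) (f v)
      simp [hu, hv]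
  · exact huv (congrArg _ hadj.1)

/-- Vertices can be isolated so that the maximum degree drops from `(1 + δ) * d` to `d`. -/
theorem exists_trimming {V ι : Type*} [Fintype V] [Fintype ι] {h : ℕ} (p : V → Option ι)
    (f : V → Fin h) (H : SimpleGraph (Fin h)) {d : ℕ} (hd : 1 ≤ d) {δ : ℝ} (hδ : 0 ≤ δ)
    (hδh : 2 * δ * h ≤ 1)
    (hdeg : ∀ a, ((nb (clusterGraph p f H) a).card : ℝ) ≤ (1 + δ) * d) :
    ∃ Z : Finset V, (Z.card : ℝ) ≤ 2 * h * δ * Fintype.card V ∧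
      ∀ q : V → Option ι, (∀ a ∈ Z, q a = none) → (∀ a ∉ Z, q a = p a) →
        ∀ a, (nb (clusterGraph q f H) a).card ≤ d := by
  classical
  have hd' : (0 : ℝ) < d := by exact_mod_cast hd
  have hsub : ∀ Z : Finset V, ∀ q : V → Option ι, (∀ a ∈ Z, q a = none) →
      (∀ a ∉ Z, q a = p a) → ∀ a b, (clusterGraph q f H).Adj a b →
      (clusterGraph p f H).Adj a b ∧ a ∉ Z ∧ b ∉ Z := by
    intro Z q hq1 hq2 a b hab
    have ha : a ∉ Z := fun ha => hab.2.1 (hq1 a ha)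
    have hb : b ∉ Z := fun hb => hab.2.1 (hab.1.trans (hq1 b hb))
    refine ⟨⟨?_, ?_, hab.2.2⟩, ha, hb⟩
    · rw [← hq2 a ha, ← hq2 b hb]
      exact hab.1
    · rw [← hq2 a ha]
      exact hab.2.1
  -- Degrees are integers, so here the bound (1 + δ)d is already d.
  by_cases hsmall : δ * d < 1
  · refine ⟨∅, by simp; positivity, fun q hq1 hq2 a => ?_⟩
    have h1 : (nb (clusterGraph q f H) a).card ≤ (nb (clusterGraph p f H) a).card :=
      Finset.card_le_card fun b hb => mem_nb.2 (hsub ∅ q hq1 hq2 a b (mem_nb.1 hb)).1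
    have h2 : ((nb (clusterGraph p f H) a).card : ℝ) < (d + 1 : ℕ) := by
      push_cast
      linarith [hdeg a]
    exact h1.trans (Nat.lt_succ_iff.1 (by exact_mod_cast h2))
  push Not at hsmall
  set z := ⌈δ * d⌉₊ with hz
  have hz1 : δ * d ≤ z := Nat.le_ceil _
  have hz2 : (z : ℝ) ≤ 2 * (δ * d) := by
    have := Nat.ceil_lt_add_one (show 0 ≤ δ * d by positivity)
    linarith
  set fib : Option ι × Fin h → Finset V := fun k => Finset.univ.filter fun a => (p a, f a) = k
    with hfib
  -- Remove `z` vertices from every cluster of size at least d/h. Since z ≤ 2δd, this is at most the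
  -- fraction 2hδ of the cluster.
  set big : Finset (Option ι × Fin h) := Finset.univ.filter fun k => d ≤ h * (fib k).card with hbig
  have hex : ∀ k ∈ big, ∃ S ⊆ fib k, S.card = z := fun k hk => by
    refine Finset.exists_subset_card_eq ?_
    have h1 : (d : ℝ) ≤ h * (fib k).card := by exact_mod_cast (Finset.mem_filter.1 hk).2
    have hh : (0 : ℝ) < h := by
      by_contra hcon
      have : (h : ℝ) * (fib k).card ≤ 0 :=
        mul_nonpos_of_nonpos_of_nonneg (not_lt.1 hcon) (by positivity)
      linarith
    have h2 : h * (z : ℝ) ≤ h * (fib k).card := by nlinarith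
    exact_mod_cast le_of_mul_le_mul_left h2 hh
  choose! S hS1 hS2 using hex
  refine ⟨big.biUnion S, ?_, fun q hq1 hq2 a => ?_⟩
  · have h1 : ((big.biUnion S).card : ℝ) ≤ ∑ k ∈ big, ((S k).card : ℝ) := by
      exact_mod_cast Finset.card_biUnion_le
    have h2 : ∑ k ∈ big, ((S k).card : ℝ) ≤ ∑ k ∈ big, 2 * h * δ * ((fib k).card : ℝ) := by
      refine Finset.sum_le_sum fun k hk => ?_
      rw [hS2 k hk]
      have h3 : (d : ℝ) ≤ h * (fib k).card := by exact_mod_cast (Finset.mem_filter.1 hk).2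
      nlinarith
    have h3 : ∑ k ∈ big, ((fib k).card : ℝ) ≤ Fintype.card V := by
      have h4 : (Finset.univ : Finset V).card = ∑ k, (fib k).card :=
        Finset.card_eq_sum_card_fiberwise fun _ _ => by simp
      rw [← Finset.card_univ, h4]
      push_cast
      exact Finset.sum_le_sum_of_subset_of_nonneg (Finset.subset_univ _) fun _ _ _ => by positivity
    rw [← Finset.mul_sum] at h2
    exact h1.trans (h2.trans (mul_le_mul_of_nonneg_left h3 (by positivity)))
  · have hq := hsub _ q hq1 hq2
    by_cases hle : (nb (clusterGraph p f H) a).card ≤ d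
    · exact (Finset.card_le_card fun b hb => mem_nb.2 (hq a b (mem_nb.1 hb)).1).trans hle
    push Not at hle
    have hane : p a ≠ none := by
      obtain ⟨b, hb⟩ := Finset.card_pos.1 (lt_of_le_of_lt (Nat.zero_le d) hle)
      exact (mem_nb.1 hb).2.1
    -- More than d neighbours spread over at most h clusters, so one of these is large, and `a`
    -- loses the `z` vertices removed from it.
    obtain ⟨j, hj, hjb⟩ : ∃ j, H.Adj (f a) j ∧ (p a, j) ∈ big := by
      by_contra! hcon
      have h1 : nb (clusterGraph p f H) a ⊆
          (Finset.univ.filter fun j => H.Adj (f a) j).biUnion fun j => fib (p a, j) := by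
        intro b hb
        have hb' := mem_nb.1 hb
        refine Finset.mem_biUnion.2 ⟨f b, Finset.mem_filter.2 ⟨Finset.mem_univ _, hb'.2.2⟩,
          Finset.mem_filter.2 ⟨Finset.mem_univ _, ?_⟩⟩
        rw [hb'.1]
      have h2 := (Finset.card_le_card h1).trans Finset.card_biUnion_le
      have h3 : h * ∑ j ∈ Finset.univ.filter (fun j => H.Adj (f a) j), (fib (p a, j)).card ≤
          h * d := by
        rw [Finset.mul_sum]
        refine (Finset.sum_le_card_nsmul _ _ d fun j hj => ?_).trans ?_
        · by_contra hcon'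
          exact hcon j (Finset.mem_filter.1 hj).2
            (Finset.mem_filter.2 ⟨Finset.mem_univ _, by omega⟩)
        · rw [smul_eq_mul]
          refine Nat.mul_le_mul_right _ ((Finset.card_filter_le _ _).trans ?_)
          simp
      have hpos : 0 < h := Fin.pos (f a)
      have h4 := Nat.le_of_mul_le_mul_left h3 hpos
      omega
    have h1 : nb (clusterGraph q f H) a ⊆ nb (clusterGraph p f H) a \ S (p a, j) := by
      intro b hb
      have hb' := hq a b (mem_nb.1 hb)
      exact Finset.mem_sdiff.2 ⟨mem_nb.2 hb'.1,
        fun hbS => hb'.2.2 (Finset.mem_biUnion.2 ⟨_, hjb, hbS⟩)⟩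
    have h2 : S (p a, j) ⊆ nb (clusterGraph p f H) a := by
      intro b hb
      have hb' := (Finset.mem_filter.1 (hS1 _ hjb hb)).2
      rw [Prod.mk.injEq] at hb'
      exact mem_nb.2 ⟨hb'.1.symm, hane, hb'.2 ▸ hj⟩
    have h3 := Finset.card_le_card h1
    rw [Finset.card_sdiff_of_subset h2, hS2 _ hjb] at h3
    have h4 : ((nb (clusterGraph p f H) a).card : ℝ) ≤ (d + z : ℕ) := by
      push_cast
      linarith [hdeg a]
    have h5 : (nb (clusterGraph p f H) a).card ≤ d + z := by exact_mod_cast h4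
    omega

/-- Each changed pair is charged to one endpoint only, and the endpoint may be chosen freely. -/
theorem editDistance_le_sum {N : ℕ} {G G' : SimpleGraph (Fin N)} (B : Fin N → Finset (Fin N))
    (hB : ∀ u w, ¬ (G.Adj u w ↔ G'.Adj u w) → w ∈ B u ∨ u ∈ B w) :
    editDistance G G' ≤ ∑ u, (B u).card := by
  classical
  rw [editDistance, ← Finset.card_sigma]
  have hsub : (G.edgeSet ∆ G'.edgeSet) ⊆
      (((Finset.univ.sigma B).image fun x => s(x.1, x.2) : Finset (Sym2 (Fin N))) :
        Set (Sym2 (Fin N))) := by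
    intro e he
    induction e using Sym2.ind with
    | _ u w =>
      rw [Set.mem_symmDiff, SimpleGraph.mem_edgeSet, SimpleGraph.mem_edgeSet] at he
      have h1 : ¬ (G.Adj u w ↔ G'.Adj u w) := by tauto
      rw [Finset.mem_coe, Finset.mem_image]
      rcases hB u w h1 with h2 | h2
      · exact ⟨⟨u, w⟩, by simpa using h2, rfl⟩
      · exact ⟨⟨w, u⟩, by simpa using h2, Sym2.eq_swap⟩
  refine (Set.ncard_le_ncard hsub (Finset.finite_toSet _)).trans ?_
  rw [Set.ncard_coe_finset]
  exact Finset.card_image_le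

open Classical in
/-- A graph that is locally close to a blow-up of `H` around most of its edges is close to a
blow-up collection of low degree. -/
theorem exists_close_of_hasLocalBlowUp {N h : ℕ} (hh : 1 ≤ h) {G : SimpleGraph (Fin N)}
    {H : SimpleGraph (Fin h)} {d : ℕ} (hd : 1 ≤ d) {κ : ℝ} (hκ : 0 ≤ κ) (hκh : 4 * κ * h ≤ 1)
    (T : Fin N → Prop) (hT : ∀ u, T u → HasLocalBlowUp G H κ d u) :
    ∃ G' : SimpleGraph (Fin N), IsBlowUpCollection G' H ∧ (∀ v, (nb G' v).card ≤ d) ∧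
      (editDistance G G' : ℝ) ≤ (2 + 8 * h) * κ * d * N +
        ∑ u ∈ Finset.univ.filter (fun u => ¬ T u), ((nb G u).card : ℝ) := by
  have hd' : (0 : ℝ) < d := by exact_mod_cast hd
  have hh' : (1 : ℝ) ≤ h := by exact_mod_cast hh
  have : Nonempty (Fin h) := ⟨⟨0, hh⟩⟩
  choose! C F hC1 hC2 hC3 using hT
  set covers : Fin N → Finset (Fin N) := fun a => Finset.univ.filter fun v => T v ∧ a ∈ C v
    with hcovers
  -- The local blow-ups may overlap; every vertex goes to the least one that covers it.
  set p : Fin N → Option (Fin N) := fun a =>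
    if ha : (covers a).Nonempty then some ((covers a).min' ha) else none with hp
  set f : Fin N → Fin h := fun a => (p a).elim (F a a) fun v => F v a with hf
  have hpsome : ∀ {a v}, p a = some v → T v ∧ a ∈ C v ∧ ∀ v', T v' → a ∈ C v' → v ≤ v' := by
    intro a v hav
    simp only [hp] at hav
    split_ifs at hav with ha
    rw [Option.some.injEq] at hav
    have h1 := Finset.min'_mem (covers a) ha
    rw [hav] at h1
    have h2 := (Finset.mem_filter.1 h1).2
    refine ⟨h2.1, h2.2, fun v' hv' hav' => ?_⟩
    rw [← hav]
    exact Finset.min'_le _ _ (Finset.mem_filter.2 ⟨Finset.mem_univ _, hv', hav'⟩)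
  have hpnone : ∀ {a}, p a = none → ∀ v, T v → a ∉ C v := by
    intro a ha v hv hav
    simp only [hp] at ha
    split_ifs at ha with ha'
    exact ha' ⟨v, Finset.mem_filter.2 ⟨Finset.mem_univ _, hv, hav⟩⟩
  have hfsome : ∀ {a v}, p a = some v → f a = F v a := by
    intro a v hav
    simp [hf, hav]
  set mis : Fin N → Fin N → Finset (Fin N) := fun v a =>
    (C v).filter fun b => ¬ (G.Adj a b ↔ H.Adj (F v a) (F v b)) with hmis
  have hdeg : ∀ a, ((nb (clusterGraph p f H) a).card : ℝ) ≤ (1 + 2 * κ) * d := by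
    intro a
    rcases ha : p a with _ | v
    · have : nb (clusterGraph p f H) a = ∅ := by
        refine Finset.eq_empty_of_forall_notMem fun b hb => ?_
        exact (mem_nb.1 hb).2.1 ha
      rw [this, Finset.card_empty, Nat.cast_zero]
      positivity
    · obtain ⟨hv, haC, -⟩ := hpsome ha
      have h1 : nb (clusterGraph p f H) a ⊆ nb G a ∪ mis v a := by
        intro b hb
        have hb' := mem_nb.1 hb
        have hpb : p b = some v := hb'.1 ▸ ha
        have h2 := hb'.2.2
        rw [hfsome ha, hfsome hpb] at h2
        by_cases hab : G.Adj a b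
        · exact Finset.mem_union_left _ (mem_nb.2 hab)
        · exact Finset.mem_union_right _ (Finset.mem_filter.2 ⟨(hpsome hpb).2.1, by tauto⟩)
      have h2 : ((nb (clusterGraph p f H) a).card : ℝ) ≤ (nb G a).card + (mis v a).card := by
        exact_mod_cast (Finset.card_le_card h1).trans (Finset.card_union_le _ _)
      have h3 := hC3 v hv a haC
      have h4 : ((mis v a).card : ℝ) ≤ κ * d := h3.2.2
      linarith [h3.2.1]
  obtain ⟨Z, hZ1, hZ2⟩ := exists_trimming p f H hd (δ := 2 * κ) (by positivity) (by linarith) hdeg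
  set q : Fin N → Option (Fin N) := fun a => if a ∈ Z then none else p a with hq
  have hq1 : ∀ a ∈ Z, q a = none := fun a ha => by simp [hq, ha]
  have hq2 : ∀ a ∉ Z, q a = p a := fun a ha => by simp [hq, ha]
  refine ⟨clusterGraph q f H, isBlowUpCollection_clusterGraph _ _ _, hZ2 q hq1 hq2, ?_⟩
  set B₁ : Fin N → Finset (Fin N) := fun a => (p a).elim (if T a then nb G a \ C a else ∅)
    fun v => mis v a ∪ (nb G a \ C v) with hB₁
  set B₂ : Fin N → Finset (Fin N) := fun a => if T a then ∅ else nb G a with hB₂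
  set B₃ : Fin N → Finset (Fin N) := fun a => if a ∈ Z then nb (clusterGraph p f H) a else ∅
    with hB₃
  -- An edge between parts is charged to its endpoint in the earlier part: the other endpoint cannot
  -- lie in `C v`, or it would have been assigned to `v` or earlier. So the edge leaves `C v`, as
  -- only κd edges at `u` do.
  have hone : ∀ u w v, p u = some v → p w ≠ some v → (∀ v', p w = some v' → v ≤ v') →
      G.Adj u w → w ∈ B₁ u := by
    intro u w v hu hw hvw hadj
    simp only [hB₁, hu, Option.elim_some]
    refine Finset.mem_union_right _ (Finset.mem_sdiff.2 ⟨mem_nb.2 hadj, fun hwC => ?_⟩)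
    have hv := (hpsome hu).1
    rcases hpw : p w with _ | v'
    · exact hpnone hpw v hv hwC
    · have h1 := hvw v' hpw
      have h2 := (hpsome hpw).2.2 v hv hwC
      exact hw (by rw [hpw, le_antisymm h2 h1])
  have hcov : ∀ u w, ¬ (G.Adj u w ↔ (clusterGraph p f H).Adj u w) →
      (w ∈ B₁ u ∨ w ∈ B₂ u) ∨ (u ∈ B₁ w ∨ u ∈ B₂ w) := by
    intro u w huw
    rcases hu : p u with _ | v
    · have hnot : ¬ (clusterGraph p f H).Adj u w := fun h => h.2.1 hu
      have hadj : G.Adj u w := by tauto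
      rcases hw : p w with _ | v'
      · by_cases hTu : T u
        · refine Or.inl (Or.inl ?_)
          simp only [hB₁, hu, Option.elim_none, hTu, if_true]
          exact Finset.mem_sdiff.2 ⟨mem_nb.2 hadj, hpnone hw u hTu⟩
        · refine Or.inl (Or.inr ?_)
          simpa [hB₂, hTu] using mem_nb.2 hadj
      · exact Or.inr (Or.inl (hone w u v' hw (by simp [hu]) (by simp [hu]) hadj.symm))
    · by_cases hw : p w = some v
      · refine Or.inl (Or.inl ?_)
        simp only [hB₁, hu, Option.elim_some]
        refine Finset.mem_union_left _ (Finset.mem_filter.2 ⟨(hpsome hw).2.1, fun h => huw ?_⟩)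
        rw [h, ← hfsome hu, ← hfsome hw]
        show _ ↔ (p u = p w ∧ p u ≠ none ∧ H.Adj (f u) (f w))
        simp [hu, hw]
      · have hnot : ¬ (clusterGraph p f H).Adj u w := fun h => hw (h.1 ▸ hu)
        have hadj : G.Adj u w := by tauto
        by_cases hvw : ∀ v', p w = some v' → v ≤ v'
        · exact Or.inl (Or.inl (hone u w v hu hw hvw hadj))
        · push Not at hvw
          obtain ⟨v', hv', hlt⟩ := hvw
          refine Or.inr (Or.inl (hone w u v' hv' ?_ ?_ hadj.symm))
          · rw [hu, Ne, Option.some.injEq]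
            exact hlt.ne'
          · intro v'' hv''
            rw [hu, Option.some.injEq] at hv''
            exact hv'' ▸ hlt.le
  have hdist := editDistance_le_sum (G := G) (G' := clusterGraph q f H)
    (fun u => B₁ u ∪ B₂ u ∪ B₃ u) (by
      intro u w huw
      by_cases h1 : G.Adj u w ↔ (clusterGraph p f H).Adj u w
      · by_cases huZ : u ∈ Z
        · have hnot : ¬ (clusterGraph q f H).Adj u w := fun h => h.2.1 (hq1 u huZ)
          have hadj : (clusterGraph p f H).Adj u w := by tauto
          exact Or.inl (Finset.mem_union_right _ (by simpa [hB₃, huZ] using mem_nb.2 hadj))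
        · by_cases hwZ : w ∈ Z
          · have hnot : ¬ (clusterGraph q f H).Adj u w := fun h => h.2.1 (h.1.trans (hq1 w hwZ))
            have hadj : (clusterGraph p f H).Adj u w := by tauto
            exact Or.inr (Finset.mem_union_right _
              (by simpa [hB₃, hwZ] using mem_nb.2 hadj.symm))
          · exfalso
            apply huw
            rw [h1]
            show (p u = p w ∧ p u ≠ none ∧ H.Adj (f u) (f w)) ↔
              (q u = q w ∧ q u ≠ none ∧ H.Adj (f u) (f w))
            rw [hq2 u huZ, hq2 w hwZ]
      · simp only [Finset.mem_union]
        rcases hcov u w h1 with h2 | h2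
        · exact Or.inl (Or.inl h2)
        · exact Or.inr (Or.inl h2))
  have hcard : ∀ u, ((B₁ u ∪ B₂ u ∪ B₃ u).card : ℝ) ≤ 2 * κ * d +
      (if ¬ T u then ((nb G u).card : ℝ) else 0) + (if u ∈ Z then 2 * (d : ℝ) else 0) := by
    intro u
    have h0 : ((B₁ u ∪ B₂ u ∪ B₃ u).card : ℝ) ≤ (B₁ u).card + (B₂ u).card + (B₃ u).card := by
      exact_mod_cast (Finset.card_union_le _ _).trans
        (Nat.add_le_add_right (Finset.card_union_le _ _) _)
    have h1 : ((B₁ u).card : ℝ) ≤ 2 * κ * d := by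
      rcases hu : p u with _ | v
      · simp only [hB₁, hu, Option.elim_none]
        split_ifs with hTu
        · have : ((nb G u \ C u).card : ℝ) ≤ κ * d := by convert hC1 u hTu
          nlinarith [mul_nonneg hκ hd'.le]
        · simp only [Finset.card_empty, Nat.cast_zero]
          positivity
      · simp only [hB₁, hu, Option.elim_some]
        obtain ⟨hv, huC, -⟩ := hpsome hu
        have h2 := hC3 v hv u huC
        have h3 : ((mis v u).card : ℝ) ≤ κ * d := h2.2.2
        have h4 : ((mis v u ∪ (nb G u \ C v)).card : ℝ) ≤
            (mis v u).card + (nb G u \ C v).card := by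
          exact_mod_cast Finset.card_union_le _ _
        have h5 : ((nb G u \ C v).card : ℝ) ≤ κ * d := by convert h2.1
        linarith
    have h2 : ((B₂ u).card : ℝ) = if ¬ T u then ((nb G u).card : ℝ) else 0 := by
      by_cases hTu : T u <;> simp [hB₂, hTu]
    have h3 : ((B₃ u).card : ℝ) ≤ if u ∈ Z then 2 * (d : ℝ) else 0 := by
      by_cases huZ : u ∈ Z
      · simp only [hB₃, huZ, if_true]
        refine (hdeg u).trans ?_
        have : κ ≤ κ * h := by nlinarith
        gcongr
        linarith
      · simp [hB₃, huZ]
    linarith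
  have hsum : ((∑ u, (B₁ u ∪ B₂ u ∪ B₃ u).card : ℕ) : ℝ) ≤ 2 * κ * d * N +
      ∑ u ∈ Finset.univ.filter (fun u => ¬ T u), ((nb G u).card : ℝ) + Z.card * (2 * d) := by
    push_cast
    refine (Finset.sum_le_sum fun u _ => hcard u).trans (le_of_eq ?_)
    rw [Finset.sum_add_distrib, Finset.sum_add_distrib, Finset.sum_const, Finset.card_univ,
      Fintype.card_fin, nsmul_eq_mul, ← Finset.sum_filter, ← Finset.sum_filter,
      Finset.sum_const, nsmul_eq_mul]
    simp only [Finset.filter_univ_mem]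
    ring
  -- Trimming with δ = 2κ isolates at most 4hκN vertices of degree at most 2d.
  have hZ' : (Z.card : ℝ) * (2 * d) ≤ 2 * h * (2 * κ) * N * (2 * d) := by
    rw [Fintype.card_fin] at hZ1
    gcongr
  calc (editDistance G (clusterGraph q f H) : ℝ)
      ≤ ((∑ u, (B₁ u ∪ B₂ u ∪ B₃ u).card : ℕ) : ℝ) := by exact_mod_cast hdist
    _ ≤ _ := hsum.trans (by linarith)

/-! ### The property, trivial cases and the final count of edits -/

theorem degree_eq_card_nb {V : Type*} [Fintype V] (G : SimpleGraph V) (v : V)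
    [Fintype (G.neighborSet v)] : G.degree v = (nb G v).card := by
  rw [← SimpleGraph.card_neighborFinset_eq_degree]
  congr 1
  ext w
  rw [SimpleGraph.mem_neighborFinset, mem_nb]

theorem mem_lowDegree_iff {δ : ℝ} {N : ℕ} (hδ : 0 ≤ δ) {G : SimpleGraph (Fin N)} :
    G ∈ lowDegree δ N ↔ ∀ v, (nb G v).card ≤ ⌊δ * N⌋₊ := by
  classical
  have h0 : 0 ≤ δ * N := by positivity
  rw [lowDegree, Set.mem_ofPred_eq, ← Nat.le_floor_iff h0]
  constructor
  · intro h v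
    rw [← degree_eq_card_nb]
    exact (G.degree_le_maxDegree v).trans h
  · intro h
    refine SimpleGraph.maxDegree_le_of_forall_degree_le G _ fun v => ?_
    rw [degree_eq_card_nb]
    exact h v

theorem editDistance_bot_le {N : ℕ} (G : SimpleGraph (Fin N)) :
    editDistance G ⊥ ≤ ∑ u, (nb G u).card :=
  editDistance_le_sum _ fun u w h => Or.inl (mem_nb.2 (by simpa using h))

theorem bot_mem_property {δ : ℝ} (hδ : 0 ≤ δ) {h : ℕ} (hh : 1 ≤ h) (H : SimpleGraph (Fin h))
    (N : ℕ) : (⊥ : SimpleGraph (Fin N)) ∈ lowDegree δ N ∩ blowUpCollections H N := by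
  have : Nonempty (Fin h) := ⟨⟨0, hh⟩⟩
  refine ⟨(mem_lowDegree_iff hδ).2 fun v => ?_, ?_⟩
  · have : nb (⊥ : SimpleGraph (Fin N)) v = ∅ :=
      Finset.eq_empty_of_forall_notMem fun w hw => mem_nb.1 hw
    simp [this]
  · have h1 := isBlowUpCollection_clusterGraph (V := Fin N) (ι := Fin 1) (fun _ => none)
      (fun _ => Classical.arbitrary (Fin h)) H
    have h2 : clusterGraph (V := Fin N) (ι := Fin 1) (fun _ => none)
        (fun _ => Classical.arbitrary (Fin h)) H = ⊥ := by
      ext u v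
      simp [clusterGraph]
    rwa [h2] at h1

/-- The empty graph has the property and is within N(N-1)/2 < N²/2 edits. -/
theorem not_isFar_of_half_le {ε δ : ℝ} (hε : 1 / 2 ≤ ε) (hδ : 0 ≤ δ) {h : ℕ} (hh : 1 ≤ h)
    (H : SimpleGraph (Fin h)) {N : ℕ} (hN : 1 ≤ N) (G : SimpleGraph (Fin N)) :
    ¬ IsFar ε (lowDegree δ N ∩ blowUpCollections H N) G := by
  classical
  intro hfar
  have h1 := hfar ⊥ (bot_mem_property hδ hh H N)
  have h2 : editDistance G ⊥ ≤ N.choose 2 := by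
    rw [editDistance, SimpleGraph.edgeSet_bot, ← Set.bot_eq_empty, symmDiff_bot,
      ← SimpleGraph.coe_edgeFinset, Set.ncard_coe_finset]
    simpa using G.card_edgeFinset_le_card_choose_two
  have h3 : (editDistance G ⊥ : ℝ) ≤ N * (N - 1) / 2 := by
    rw [← Nat.cast_choose_two]
    exact_mod_cast h2
  have hN' : (1 : ℝ) ≤ N := by exact_mod_cast hN
  nlinarith

/-- Here S is the degree sum and B the share of the bad vertices. The conditions on B force B ≤
εN²/4, and the choice of κ makes the other term at most εN²/2. -/
theorem edit_bound {c κ ε d N S B h : ℝ} (hc : 1 < c) (hκ0 : 0 ≤ κ) (hκ : κ * (32 * c * h) ≤ 1)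
    (hh : 1 ≤ h) (hN : 0 < ε * N ^ 2 ∧ 0 ≤ N) (hd : d ≤ c * ε * N) (hB : B * (16 * c) ≤ S)
    (hS : S ≤ 2 * d * N + B) (hB0 : 0 ≤ B) :
    (2 + 8 * h) * κ * d * N + B < ε * N ^ 2 := by
  obtain ⟨hεN, hN0⟩ := hN
  have hdN : d * N ≤ c * (ε * N ^ 2) := by
    have := mul_le_mul_of_nonneg_right hd hN0
    linarith
  have hB1 : B ≤ 1 / 4 * (ε * N ^ 2) := by
    have h0 : B * 1 ≤ B * (8 * c) := mul_le_mul_of_nonneg_left (by linarith) hB0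
    have h1 : B * (8 * c) ≤ 2 * (d * N) := by linarith
    refine le_of_mul_le_mul_right ?_ (show 0 < 8 * c by linarith)
    linarith
  have h1 : (2 + 8 * h) * κ * (d * N) ≤ (2 + 8 * h) * κ * (c * (ε * N ^ 2)) :=
    mul_le_mul_of_nonneg_left hdN (by positivity)
  have h2 : (2 + 8 * h) * κ * c ≤ 1 / 2 := by
    have h3 : 0 ≤ κ * c := by positivity
    have h4 : κ * c * 1 ≤ κ * c * h := mul_le_mul_of_nonneg_left hh h3
    linarith
  have h5 := mul_le_mul_of_nonneg_right h2 hεN.le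
  linarith

/-! ### Amplification, completeness and soundness of a round -/

namespace Prog

theorem isTester_toPMF {N : ℕ} {p : Prog N Bool} {ε : ℝ} {P : Set (SimpleGraph (Fin N))}
    (h1 : ∀ G ∈ P, rej (oracle G) p < 1 / 3) (h2 : ∀ G, IsFar ε P G → 2 / 3 < rej (oracle G) p) :
    AdaptiveAlgorithm.IsTester p.toPMF ε P := by
  have h0 : (2 / 3 : ℝ≥0∞) = ENNReal.ofReal (2 / 3) := by
    rw [ENNReal.ofReal_div_of_pos (by norm_num)]
    norm_num
  refine ⟨fun G hG => ?_, fun G hG => ?_⟩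
  · rw [AdaptiveAlgorithm.verdict, map_run_toPMF, h0]
    have h3 := h1 G hG
    rw [rej, expect_eq_false] at h3
    exact (ENNReal.ofReal_lt_ofReal_iff (by linarith)).2 (by linarith)
  · rw [AdaptiveAlgorithm.verdict, map_run_toPMF, h0]
    have h3 := h2 G hG
    exact (ENNReal.ofReal_lt_ofReal_iff (by rw [rej] at h3; linarith)).2 h3

theorem rej_repeatAll {N : ℕ} (g : Fin N → Fin N → Bool) (p : Prog N Bool) (t : ℕ) :
    rej g (repeatAll p t) = 1 - (1 - rej g p) ^ t := by
  rw [rej, rej, expect_eq_false, expect_eq_false, expect_repeatAll]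
  ring

theorem rej_le_one {N : ℕ} (g : Fin N → Fin N → Bool) (p : Prog N Bool) : rej g p ≤ 1 :=
  (expect_mono g p fun a => by split_ifs <;> norm_num).trans (expect_const g p 1).le

/-- A test that rejects far graphs with probability at least `η`, and graphs with the property
with much smaller probability, can be amplified to a tester by repetition. -/
theorem isTester_repeatAll {N : ℕ} {p : Prog N Bool} {ε η : ℝ} {P : Set (SimpleGraph (Fin N))}
    {t : ℕ} (hη : (1 - η) ^ t < 1 / 3) (h1 : ∀ G ∈ P, t * rej (oracle G) p < 1 / 3)
    (h2 : ∀ G, IsFar ε P G → η ≤ rej (oracle G) p) :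
    AdaptiveAlgorithm.IsTester (repeatAll p t).toPMF ε P := by
  refine isTester_toPMF (fun G hG => ?_) fun G hG => ?_
  · rw [rej_repeatAll]
    have h3 := one_add_mul_le_pow (a := -rej (oracle G) p)
      (by linarith [rej_le_one (oracle G) p]) t
    have h4 := h1 G hG
    rw [← sub_eq_add_neg] at h3
    linarith
  · rw [rej_repeatAll]
    have h3 : (1 - rej (oracle G) p) ^ t ≤ (1 - η) ^ t :=
      pow_le_pow_left₀ (by linarith [rej_le_one (oracle G) p]) (by linarith [h2 G hG]) t
    linarith

variable {n h : ℕ} {H : SimpleGraph (Fin h)} {c ε γ : ℝ} {m : ℕ}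

theorem rej_trial_le_of_mem (hc : 0 < c) (hε : 0 < ε) (hγ : 0 < γ) (hm : 0 < m)
    {G : SimpleGraph (Fin (n + 1))}
    (hG : G ∈ lowDegree (c * ε) (n + 1) ∩ blowUpCollections H (n + 1)) :
    rej (oracle G) (trial n H m ((1 + γ / 2) * (⌊c * ε * (n + 1 : ℕ)⌋₊ : ℝ) * m / (n + 1))
      (decide (1 ≤ ⌊c * ε * (n + 1 : ℕ)⌋₊))) ≤ (2 * h + 2) * (8 / (γ ^ 2 * (c * ε) * m)) := by
  have hdeg := (mem_lowDegree_iff (by positivity)).1 hG.1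
  set d := ⌊c * ε * (n + 1 : ℕ)⌋₊ with hd
  have hm' : (0 : ℝ) < m := by exact_mod_cast hm
  by_cases hd1 : 1 ≤ d
  · rw [decide_eq_true hd1]
    have hd' : (1 : ℝ) ≤ d := by exact_mod_cast hd1
    refine (rej_trial_true_le hγ (by linarith) hm (fun x => by exact_mod_cast hdeg x) hG.2).trans ?_
    push_cast
    refine mul_le_mul_of_nonneg_left ?_ (by positivity)
    -- Since d ≥ 1, rounding down loses at most a factor 2.
    have h1 : c * ε * (n + 1) ≤ 2 * d := by
      have := Nat.lt_floor_add_one (c * ε * (n + 1 : ℕ))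
      rw [← hd] at this
      push_cast at this
      linarith
    rw [div_le_div_iff₀ (by positivity) (by positivity)]
    have h2 : 4 * γ ^ 2 * m * (c * ε * (n + 1)) ≤ 4 * γ ^ 2 * m * (2 * d) := by gcongr
    linarith
  · rw [decide_eq_false hd1, rej_trial_false_eq_zero fun u v huv => ?_]
    · positivity
    · have h1 : 0 < (nb G u).card := Finset.card_pos.2 ⟨v, mem_nb.2 huv⟩
      have := hdeg u
      omega

set_option maxHeartbeats 800000 in
theorem le_rej_trial_of_isFar (hc : 1 < c) (hε : 0 < ε) (hh : 1 ≤ h) {κ τ ρ : ℝ}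
    (hκ : κ * (32 * c * h) = 1) (hγ : 40 * (h + 1) ^ 2 * γ = κ) (hτ0 : 0 < τ) (hτ1 : τ ≤ 1)
    (hτ : 3 * (2 * h + 2) * τ * (h + 1) ≤ γ)
    (hρ : ρ = (1 / 2) ^ ((2 * h + 2) * (2 * h + 2))) (hm1 : 1 ≤ m * ε)
    (hm : 64 ≤ m * (γ ^ 2 * (c * ε))) {G : SimpleGraph (Fin (n + 1))}
    (hG : IsFar ε (lowDegree (c * ε) (n + 1) ∩ blowUpCollections H (n + 1)) G) :
    ρ * τ ^ (2 * h + 1) / (32 * c) ≤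
      rej (oracle G) (trial n H m ((1 + γ / 2) * (⌊c * ε * (n + 1 : ℕ)⌋₊ : ℝ) * m / (n + 1))
        (decide (1 ≤ ⌊c * ε * (n + 1 : ℕ)⌋₊))) := by
  classical
  set d := ⌊c * ε * (n + 1 : ℕ)⌋₊ with hd
  have hh' : (1 : ℝ) ≤ h := by exact_mod_cast hh
  have hκ0 : 0 < κ := by
    by_contra hcon
    have : κ * (32 * c * h) ≤ 0 :=
      mul_nonpos_of_nonpos_of_nonneg (not_lt.1 hcon) (by positivity)
    linarith
  have hκ1 : κ ≤ 1 := by nlinarith [mul_le_mul hc.le hh' zero_le_one (by linarith)]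
  have hγ0 : 0 < γ := by
    by_contra hcon
    have : 40 * ((h : ℝ) + 1) ^ 2 * γ ≤ 0 :=
      mul_nonpos_of_nonneg_of_nonpos (by positivity) (not_lt.1 hcon)
    linarith
  have hγ1 : γ ≤ 1 := by nlinarith
  have hρ0 : 0 < ρ := by rw [hρ]; positivity
  have hρ1 : ρ ≤ 1 := by rw [hρ]; exact pow_le_one₀ (by norm_num) (by norm_num)
  have hL0 : 0 < ρ * τ ^ (2 * h + 1) := by positivity
  have hL1 : ρ * τ ^ (2 * h + 1) ≤ 1 :=
    mul_le_one₀ hρ1 (by positivity) (pow_le_one₀ hτ0.le hτ1)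
  have hm0' : (0 : ℝ) < m := by
    by_contra hcon
    have : (m : ℝ) * ε ≤ 0 := mul_nonpos_of_nonpos_of_nonneg (not_lt.1 hcon) hε.le
    linarith
  have hm0 : 0 < m := by exact_mod_cast hm0'
  set S := ∑ u, ((nb G u).card : ℝ) with hS
  -- A far graph is far from the empty graph, hence has enough edges for the edge search.
  have hSε : ε * ((n : ℝ) + 1) ^ 2 ≤ S := by
    have h1 := hG ⊥ (bot_mem_property (by positivity) hh H _)
    have h2 : (editDistance G ⊥ : ℝ) ≤ S := by
      rw [hS]
      exact_mod_cast editDistance_bot_le G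
    push_cast at h1
    linarith
  have hmS : ((n : ℝ) + 1) ^ 2 ≤ m * S := by
    have h1 : m * (ε * ((n : ℝ) + 1) ^ 2) ≤ m * S := mul_le_mul_of_nonneg_left hSε hm0'.le
    have h2 : 1 * ((n : ℝ) + 1) ^ 2 ≤ m * ε * (n + 1) ^ 2 :=
      mul_le_mul_of_nonneg_right hm1 (by positivity)
    linarith
  by_cases hd1 : 1 ≤ d
  swap
  · rw [decide_eq_false hd1]
    refine le_trans ?_ (half_le_rej_trial_false hm0 hmS)
    rw [div_le_div_iff₀ (by positivity) (by norm_num)]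
    linarith
  rw [decide_eq_true hd1]
  have hd1' : (1 : ℝ) ≤ d := by exact_mod_cast hd1
  have hd0 : (0 : ℝ) < d := by linarith
  have hdle : (d : ℝ) ≤ c * ε * (n + 1) := by
    have := Nat.floor_le (show 0 ≤ c * ε * ((n + 1 : ℕ) : ℝ) by positivity)
    rw [← hd] at this
    push_cast at this
    exact this
  have hdge : c * ε * (n + 1) ≤ 2 * d := by
    have := Nat.lt_floor_add_one (c * ε * (n + 1 : ℕ))
    rw [← hd] at this
    push_cast at this
    linarith
  have hn0 : (0 : ℝ) < n + 1 := by positivity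
  have hmd : 32 * (n + 1 : ℝ) ≤ m * (γ ^ 2 * d) := by
    have h1 : m * γ ^ 2 * (c * ε * (n + 1)) ≤ m * γ ^ 2 * (2 * d) := by gcongr
    have h2 : 64 * (n + 1 : ℝ) ≤ m * (γ ^ 2 * (c * ε)) * (n + 1) := by gcongr
    linarith
  have hmd' : (n + 1 : ℝ) ≤ m * d := by
    have : m * (γ ^ 2 * d) ≤ m * (1 * d) := by
      have : γ ^ 2 ≤ 1 := pow_le_one₀ hγ0.le hγ1
      gcongr
    linarith
  set θ := (1 + γ / 2) * (d : ℝ) * m / (n + 1) with hθ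
  by_contra hcon
  push Not at hcon
  have hR : RejectionBounds G H γ d ρ (3 * (2 * h + 2))
      (fun r X => rej (oracle G) (explore H m θ r X)) := by
    refine ⟨fun r X => rej_nonneg _ _, fun r X hX hRef => ?_, fun r X hX x hx hdx => ?_⟩
    · rw [hρ]
      exact rej_explore_ge hγ0 hγ1 hd0 hmd r hRef hX.le
    · exact sum_rej_explore_le hd0 hmd' r (by omega) hx hdx
  set T : Fin (n + 1) → Prop := fun u =>
    rej (oracle G) (explore H m θ (2 * h + 1) [u]) < ρ * τ ^ (2 * h + 1) with hTdef
  have hT : ∀ u, T u → HasLocalBlowUp G H κ d u := fun u hu =>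
    hR.hasLocalBlowUp hρ0 hτ0 hτ1 hγ0 hγ1 hd0 (by positivity) hτ hh hu hγ.le
  obtain ⟨G', hG'1, hG'2, hG'3⟩ := exists_close_of_hasLocalBlowUp hh hd1 hκ0.le
    (by nlinarith) T hT
  set Sb := ∑ u ∈ Finset.univ.filter (fun u => ¬ T u), ((nb G u).card : ℝ) with hSb
  -- Markov's inequality with vertices weighted by degree.
  have hSb1 : Sb * (ρ * τ ^ (2 * h + 1)) ≤ 2 * S * (ρ * τ ^ (2 * h + 1) / (32 * c)) := by
    have h1 := sum_degree_rej_explore_le (G := G) (H := H) (θ := θ) hm0 hmS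
    have h2 : Sb * (ρ * τ ^ (2 * h + 1)) ≤
        ∑ u, ((nb G u).card : ℝ) * rej (oracle G) (explore H m θ (2 * h + 1) [u]) := by
      rw [hSb, Finset.sum_mul]
      refine le_trans (Finset.sum_le_sum fun u hu => ?_)
        (Finset.sum_le_sum_of_subset_of_nonneg (Finset.filter_subset _ _)
          fun u _ _ => mul_nonneg (Nat.cast_nonneg _) (rej_nonneg _ _))
      exact mul_le_mul_of_nonneg_left (not_lt.1 (Finset.mem_filter.1 hu).2) (Nat.cast_nonneg _)
    refine h2.trans (h1.trans ?_)
    have hS0 : 0 ≤ S := Finset.sum_nonneg fun _ _ => Nat.cast_nonneg _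
    exact mul_le_mul_of_nonneg_left hcon.le (mul_nonneg zero_le_two hS0)
  have hSb2 : Sb * (16 * c) ≤ S := by
    refine le_of_mul_le_mul_right ?_ hL0
    have h1 : 2 * S * (ρ * τ ^ (2 * h + 1) / (32 * c)) * (16 * c) =
        S * (ρ * τ ^ (2 * h + 1)) := by
      generalize ρ * τ ^ (2 * h + 1) = L
      have : c ≠ 0 := by linarith
      clear_value S Sb
      clear * - this
      field_simp
      ring
    rw [← h1]
    have := mul_le_mul_of_nonneg_right hSb1 (show 0 ≤ 16 * c by linarith)
    linarith
  have hSb0 : 0 ≤ Sb := Finset.sum_nonneg fun _ _ => Nat.cast_nonneg _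
  have hS2 : S ≤ 2 * d * (n + 1) + Sb := by
    have h1 : S = ∑ u ∈ Finset.univ.filter T, ((nb G u).card : ℝ) + Sb :=
      (Finset.sum_filter_add_sum_filter_not _ _ _).symm
    have h2 : ∑ u ∈ Finset.univ.filter T, ((nb G u).card : ℝ) ≤ (n + 1) * (2 * d) := by
      have h3 := Finset.sum_le_card_nsmul (Finset.univ.filter T)
        (fun u => ((nb G u).card : ℝ)) (2 * d) fun u hu => by
          obtain ⟨_, _, _, h4, _⟩ := hT u (Finset.mem_filter.1 hu).2
          exact h4
      rw [nsmul_eq_mul] at h3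
      have h5 : ((Finset.univ.filter T).card : ℝ) ≤ n + 1 := by
        have : (Finset.univ.filter T).card ≤ n + 1 :=
          (Finset.card_filter_le _ _).trans (by simp)
        exact_mod_cast this
      refine h3.trans ?_
      gcongr
    linarith
  have hfar := hG G' ⟨(mem_lowDegree_iff (by positivity)).2 hG'2, hG'1⟩
  push_cast at hfar hG'3
  exact absurd (hfar.trans hG'3) (not_le.2 (edit_bound hc hκ0.le (by linarith) hh' ⟨by positivity, hn0.le⟩
    hdle hSb2 hS2 hSb0))

end Prog

/-! ### Choice of constants -/

/-- The tester on graphs with a positive number of vertices. -/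
noncomputable def tester {h : ℕ} (H : SimpleGraph (Fin h)) (c γ a ε : ℝ) (t n : ℕ) :
    Prog (n + 1) Bool :=
  open Classical in
  if h = 0 then Prog.ret false else if 1 / 2 ≤ ε then Prog.ret true else
    Prog.repeatAll (Prog.trial n H ⌈a / ε⌉₊
      ((1 + γ / 2) * (⌊c * ε * (n + 1 : ℕ)⌋₊ : ℝ) * ⌈a / ε⌉₊ / (n + 1))
      (decide (1 ≤ ⌊c * ε * (n + 1 : ℕ)⌋₊))) t

theorem exists_tester {h : ℕ} (H : SimpleGraph (Fin h)) {c : ℝ} (hc : 1 < c) :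
    ∃ (C : ℝ) (p : ℝ → (n : ℕ) → Prog (n + 1) Bool), 0 < C ∧ ∀ ε : ℝ, 0 < ε → ε < 1 → ∀ n : ℕ,
      AdaptiveAlgorithm.IsTester (p ε n).toPMF ε
        (lowDegree (c * ε) (n + 1) ∩ blowUpCollections H (n + 1)) ∧
      ∃ q : ℕ, (p ε n).CostLE q ∧ (q : ℝ) ≤ C * (ε⁻¹ * Real.logb 2 ε⁻¹ ^ 3) := by
  have hc0 : 0 < c := by linarith
  rcases Nat.eq_zero_or_pos h with hh0 | hh
  · subst hh0
    -- For h = 0 no graph with a vertex has the property, so rejecting is always right.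
    refine ⟨1, fun _ _ => Prog.ret false, one_pos, fun ε hε hε1 n => ⟨?_, 0, trivial, ?_⟩⟩
    · refine Prog.isTester_toPMF (fun G hG => ?_) fun G _ => ?_
      · obtain ⟨k, part, hpart, -⟩ := hG.2
        obtain ⟨f, -⟩ := hpart (part 0)
        exact (f ⟨0, rfl⟩).elim0
      · simp only [Prog.rej, Prog.expect, if_true]
        norm_num
    · have : 0 ≤ Real.logb 2 ε⁻¹ :=
        Real.logb_nonneg (by norm_num) (one_le_inv_iff₀.2 ⟨hε, hε1.le⟩)
      push_cast
      positivity
  have hh' : (1 : ℝ) ≤ h := by exact_mod_cast hh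
  set κ : ℝ := 1 / (32 * c * h) with hκ
  set γ : ℝ := κ / (40 * (h + 1) ^ 2) with hγ
  set τ : ℝ := γ / (3 * (2 * h + 2) * (h + 1)) with hτ
  set ρ : ℝ := (1 / 2) ^ ((2 * h + 2) * (2 * h + 2)) with hρ
  set η : ℝ := ρ * τ ^ (2 * h + 1) / (32 * c) with hη
  have hκ0 : 0 < κ := by positivity
  have hγ0 : 0 < γ := by positivity
  have hτ0 : 0 < τ := by positivity
  have hκ1 : κ ≤ 1 := by
    rw [hκ, div_le_one (by positivity)]
    nlinarith
  have hγ1 : γ ≤ 1 := by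
    rw [hγ, div_le_one (by positivity)]
    nlinarith
  have hτ1 : τ ≤ 1 := by
    rw [hτ, div_le_one (by positivity)]
    nlinarith
  have hη0 : 0 < η := by positivity
  -- The bound η does not depend on the sample size, so the number t of rounds can be fixed first;
  -- `a` is then taken large enough that even t rounds rarely reject a graph with the property.
  obtain ⟨t, ht⟩ := exists_pow_lt_of_lt_one (show (0 : ℝ) < 1 / 3 by norm_num)
    (show 1 - η < 1 by linarith)
  set a : ℝ := 1 + (64 + 32 * t * (2 * h + 2)) / (γ ^ 2 * c) with ha
  have ha1 : 1 ≤ a := by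
    rw [ha, le_add_iff_nonneg_right]
    positivity
  have haγ : 64 + 32 * t * (2 * h + 2) ≤ a * (γ ^ 2 * c) := by
    rw [ha, add_mul, div_mul_cancel₀ _ (by positivity)]
    have : 0 ≤ 1 * (γ ^ 2 * c) := by positivity
    linarith
  set Q : ℕ := 3 * (2 * h + 2) * (2 * h + 2) + 2 * (2 * h + 2) with hQ
  refine ⟨t * Q * (a + 1) + 1, fun ε n => tester H c γ a ε t n, by positivity, fun ε hε hε1 n => ?_⟩
  have hlog0 : 0 ≤ Real.logb 2 ε⁻¹ :=
    Real.logb_nonneg (by norm_num) (one_le_inv_iff₀.2 ⟨hε, hε1.le⟩)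
  have hh0 : h ≠ 0 := by omega
  by_cases hε2 : 1 / 2 ≤ ε
  · simp only [tester, hh0, if_false, hε2, if_true]
    refine ⟨Prog.isTester_toPMF (fun G _ => ?_) fun G hG => ?_, 0, trivial, ?_⟩
    · simp [Prog.rej, Prog.expect]
    · exact (not_isFar_of_half_le hε2 (by positivity) hh H (by omega) G hG).elim
    · push_cast
      positivity
  simp only [tester, hh0, if_false, hε2]
  set m : ℕ := ⌈a / ε⌉₊ with hm
  have hma : a ≤ m * ε := by
    rw [← div_le_iff₀ hε]
    exact Nat.le_ceil _
  have hm1 : 1 ≤ m := Nat.one_le_ceil_iff.2 (by positivity)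
  have hm0 : (0 : ℝ) < m := by exact_mod_cast hm1
  have hmγ : 64 + 32 * t * (2 * h + 2) ≤ m * (γ ^ 2 * (c * ε)) := by
    have h1 : a * (γ ^ 2 * c) ≤ m * ε * (γ ^ 2 * c) := by gcongr
    linarith
  refine ⟨Prog.isTester_repeatAll ht (fun G hG => ?_) fun G hG => ?_, t * (m * Q),
    Prog.costLE_repeatAll (Prog.costLE_trial H hm1 _ _) t, ?_⟩
  · have h1 := Prog.rej_trial_le_of_mem hc0 hε hγ0 hm1 hG
    have h2 : (t : ℝ) * ((2 * h + 2) * (8 / (γ ^ 2 * (c * ε) * m))) < 1 / 3 := by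
      have h3 : (t : ℝ) * ((2 * h + 2) * (8 / (γ ^ 2 * (c * ε) * m))) =
          8 * t * (2 * h + 2) / (γ ^ 2 * (c * ε) * m) := by ring
      rw [h3, div_lt_div_iff₀ (by positivity) (by norm_num)]
      have h4 : (0 : ℝ) ≤ t * (2 * h + 2) := by positivity
      linarith
    exact lt_of_le_of_lt (mul_le_mul_of_nonneg_left h1 (Nat.cast_nonneg t)) h2
  · refine Prog.le_rej_trial_of_isFar hc hε hh (κ := κ) ?_ ?_ hτ0 hτ1 ?_ hρ (ha1.trans hma) ?_ hG
    · rw [hκ]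
      exact div_mul_cancel₀ _ (by positivity)
    · rw [hγ]
      exact mul_div_cancel₀ _ (by positivity)
    · rw [hτ]
      refine le_of_eq ?_
      field_simp
    · refine le_trans ?_ hmγ
      have : (0 : ℝ) ≤ 32 * t * (2 * h + 2) := by positivity
      linarith
  · have h1 : (m : ℝ) ≤ (a + 1) * ε⁻¹ := by
      have h2 := Nat.ceil_lt_add_one (show 0 ≤ a / ε by positivity)
      have h3 : 1 ≤ ε⁻¹ := one_le_inv_iff₀.2 ⟨hε, hε1.le⟩
      rw [← hm, div_eq_mul_inv] at h2
      linarith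
    -- This is where ε < 1/2 is needed: near ε = 1 the logarithm vanishes, and the tester there
    -- makes no queries.
    have h2 : 1 ≤ Real.logb 2 ε⁻¹ ^ 3 := by
      refine one_le_pow₀ ?_
      rw [Real.le_logb_iff_rpow_le (by norm_num) (by positivity), Real.rpow_one,
        le_inv_comm₀ (by norm_num) hε]
      norm_num
      linarith
    push_cast
    calc (t : ℝ) * (m * Q) ≤ t * ((a + 1) * ε⁻¹ * Q) := by gcongr
      _ = t * Q * (a + 1) * ε⁻¹ := by ring
      _ ≤ (t * Q * (a + 1) + 1) * ε⁻¹ * 1 := by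
        rw [mul_one]
        gcongr
        linarith
      _ ≤ (t * Q * (a + 1) + 1) * ε⁻¹ * Real.logb 2 ε⁻¹ ^ 3 := by gcongr
      _ = _ := by ring

end DenseGraphTesting

theorem mainTheorem2 {h : ℕ} (H : SimpleGraph (Fin h)) (c : ℝ) (hc : 1 < c) :
    ∃ C : ℝ, 0 < C ∧
      ∃ A : (ε : ℝ) → (N : ℕ) → DenseGraphTesting.AdaptiveAlgorithm N,
        ∀ ε : ℝ, 0 < ε → ε < 1 → ∀ N : ℕ, 1 ≤ N →
          (A ε N).IsTester ε
            (DenseGraphTesting.lowDegree (c * ε) N ∩ DenseGraphTesting.blowUpCollections H N) ∧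
          (A ε N).MakesAtMost (C * (ε⁻¹ * Real.logb 2 ε⁻¹ ^ 3)) := by
  obtain ⟨C, p, hC, hp⟩ := DenseGraphTesting.exists_tester H hc
  refine ⟨C, hC, fun ε N => match N with
    | 0 => PMF.pure (DenseGraphTesting.DecisionTree.output true)
    | n + 1 => (p ε n).toPMF, fun ε hε hε1 N hN => ?_⟩
  cases N with
  | zero => omega
  | succ n =>
    obtain ⟨h1, q, hq, hqC⟩ := hp ε hε hε1 n
    refine ⟨h1, fun T hT G => le_trans ?_ hqC⟩
    exact_mod_cast DenseGraphTesting.Prog.queryCount_le_of_mem_support hq hT _
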